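/- **Setting.** Fix a vocabulary of predicate symbols and function symbols of given arities, with infinitely many object symbols ($0$-ary function symbols, which may occur free or be bound by quantifiers). FO-formulas are built from atoms $P(\bar t)$, $t=s$, $\top$, $\bot$ with $\lnot,\land,\lor,\Rightarrow,\Leftrightarrow,\forall,\exists$; they are considered up to renaming of bound symbols, so that substitution never captures. An occurrence in a formula is *negative* if, after unwinding $\Rightarrow$ and $\Leftrightarrow$ in terms of $\lnot,\land,\lor$, it is in the scope of an odd number of negations, and *positive* otherwise. A *definition* is a finite set $\Phi$ of rules $\forall\bar x: P(\bar t)\leftarrow\varphi$ with $\varphi$ (the *body*) an FO-formula; $\mathrm{Def}(\Phi)$ is the set of predicate symbols occurring in heads $P(\bar t)$ of its rules, and $\mathrm{Par}(\Phi)$ is the set of the other non-logical symbols occurring in $\Phi$. The symbols $\bar x$ are bound by the rule and may be renamed. FO(ID)-formulas are built from atoms and definitions with the connectives and quantifiers. A definition $\Phi$ is *stratified* if there is $\ell:\mathrm{Def}(\Phi)\to\mathbb N$ such that for every rule $\forall\bar x: P(\bar t)\leftarrow\varphi$ of $\Phi$ and every $Q\in\mathrm{Def}(\Phi)$: $\ell(Q)\le\ell(P)$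 if $Q$ occurs in $\varphi$, and $\ell(Q)<\ell(P)$ if $Q$ occurs negatively in $\varphi$. **Calculus.** A sequent $\Gamma\vdash\Delta$ consists of two *sets* of FO(ID)-formulas; a comma denotes union (so a principal formula may also be kept in the premises). A proof is a finite tree built with the following rules. * (ax) $\Gamma\vdash\Delta$ if $\Gamma\cap\Delta\ne\emptyset$, $\bot\in\Gamma$ or $\top\in\Delta$. (wk) From $\Gamma'\vdash\Delta'$ infer $\Gamma\vdash\Delta$ if $\Gamma'\subseteq\Gamma$, $\Delta'\subseteq\Delta$. (subst) From $\Gamma\vdash\Delta$ infer $\Gamma[t/x]\vdash\Delta[t/x]$. (cut) From $\Gamma\vdash\varphi,\Delta$ and $\Gamma,\varphi\vdash\Delta$ infer $\Gamma\vdash\Delta$; here $\varphi$ is the *cut formula*. * The left and right rules for $\lnot,\lor,\land,\Rightarrow,\Leftrightarrow$, respectively: from $\Gamma\vdash\varphi,\Delta$ infer $\Gamma,\lnot\varphi\vdash\Delta$; from $\Gamma,\varphi\vdash\Delta$ infer $\Gamma\vdash\lnot\varphi,\Delta$; from $\Gamma,\varphi\vdash\Delta$ and $\Gamma,\psi\vdash\Delta$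 infer $\Gamma,\varphi\lor\psi\vdash\Delta$; from $\Gamma\vdash\varphi,\psi,\Delta$ infer $\Gamma\vdash\varphi\lor\psi,\Delta$; from $\Gamma,\varphi,\psi\vdash\Delta$ infer $\Gamma,\varphi\land\psi\vdash\Delta$; from $\Gamma\vdash\varphi,\Delta$ and $\Gamma\vdash\psi,\Delta$ infer $\Gamma\vdash\varphi\land\psi,\Delta$; from $\Gamma\vdash\varphi,\Delta$ and $\Gamma,\psi\vdash\Delta$ infer $\Gamma,\varphi\Rightarrow\psi\vdash\Delta$; from $\Gamma,\varphi\vdash\psi,\Delta$ infer $\Gamma\vdash\varphi\Rightarrow\psi,\Delta$; from $\Gamma\vdash\varphi,\psi,\Delta$ and $\Gamma,\varphi,\psi\vdash\Delta$ infer $\Gamma,\varphi\Leftrightarrow\psi\vdash\Delta$; from $\Gamma,\varphi\vdash\psi,\Delta$ and $\Gamma,\psi\vdash\varphi,\Delta$ infer $\Gamma\vdash\varphi\Leftrightarrow\psi,\Delta$. * From $\Gamma,\varphi[t/x]\vdash\Delta$ infer $\Gamma,\forall x:\varphi\vdash\Delta$, and from $\Gamma\vdash\varphi[t/x],\Delta$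 infer $\Gamma\vdash\exists x:\varphi,\Delta$, for any term $t$. If $x$ is not free in $\Gamma\cup\Delta$: from $\Gamma\vdash\varphi,\Delta$ infer $\Gamma\vdash\forall x:\varphi,\Delta$, and from $\Gamma,\varphi\vdash\Delta$ infer $\Gamma,\exists x:\varphi\vdash\Delta$. * ($=$L) For $x\neq y$, from $\Gamma[s/x,t/y]\vdash\Delta[s/x,t/y]$ infer $\Gamma[t/x,s/y],\,t=s\vdash\Delta[t/x,s/y]$. ($=$R) $\Gamma\vdash t=t,\Delta$. * (def R) If $\forall\bar x:P(\bar t)\leftarrow\varphi$ is a rule of $\Phi$ and $\bar s$ is a tuple of terms: from $\Gamma,\Phi\vdash\varphi[\bar s/\bar x],\Delta$ infer $\Gamma,\Phi\vdash P(\bar t[\bar s/\bar x]),\Delta$. * (def L) Let $P\in\Pi\subseteq\mathrm{Def}(\Phi)$ and, for each $Q\in\Pi$, let $F_Q[\bar z]$ be an FO-formula with a tuple $\bar z$ of distinct object symbols of the arity of $Q$. From $\Gamma,\Phi,F_P[\bar v]\vdash\Delta$ and the premises $\Gamma,\Phi,\psi[F_\Pi/\Pi^+]\vdash F_Q[\bar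 s],\Delta$ for all rules $\forall\bar y:Q(\bar s)\leftarrow\psi$ of $\Phi$ with $Q\in\Pi$, infer $\Gamma,\Phi,P(\bar v)\vdash\Delta$. Here $\psi[F_\Pi/\Pi^+]$ results from $\psi$ by replacing every positive occurrence of an atom $R(\bar u)$ with $R\in\Pi$ by $F_R[\bar u]$ (equivalences containing such atoms being unwound), and the bound symbols $\bar y$ of the rules of $\Phi$ are distinct and not free in $\Gamma$, $\Delta$, $\Phi$, nor free in any $F_Q$ ($Q\in\Pi$) other than as one of its place holders $\bar z$. A sequent is *provable* if it has a proof, with arbitrary FO(ID)-formulas as cut formulas. **Canonical sequents.** A sequent $\Gamma,\Phi_1,\dots,\Phi_n\vdash\Delta$ with $\Phi_1,\dots,\Phi_n$ definitions and $\Gamma,\Delta$ finite sets of FO-formulas is *canonical* if for all $i,j$: (i) the body of each rule of $\Phi_i$ is composed of literals (atoms and negated atoms) by $\land$ and $\lor$; (ii) $\mathrm{Def}(\Phi_i)\cap\mathrm{Def}(\Phi_j)=\emptyset$ if $i\ne j$; (iii) $\mathrm{Def}(\Phi_i)\cap\mathrm{Par}(\Phi_j)=\emptyset$ if $j<i$.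 It is *provable with elementary cuts* if it has a proof in which every cut formula is of the form $\forall\bar y: Q(\bar y)\lor\lnot Q(\bar y)$, where $Q$ is a predicate symbol that occurs negatively in the body of a rule of some $\Phi_i$ and $\bar y$ is a tuple of distinct object symbols. **Theorem (Cut-restriction).** Let $\Gamma,\Phi_1,\dots,\Phi_n\vdash\Delta$ be a canonical sequent such that the definitions $\Phi_1,\dots,\Phi_n$ are stratified. If $\Gamma,\Phi_1,\dots,\Phi_n\vdash\Delta$ is provable, then it is provable with elementary cuts. -/

import Mathlib

universe u v w

namespace SCFOID

/-! ### Syntax of FO(ID)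

A vocabulary is given by a first-order language `L` (function and predicate symbols) together with a
type `α` of object symbols.  Bound object symbols are represented by indices, so that formulas are
syntactic expressions up to renaming of bound symbols and substitution never captures.  The types
`Tm L α n`, `FO L α n`, ... contain the expressions with `n` bound symbols `0, ..., n - 1` in scope;
the terms and formulas proper are those with `n = 0`. -/

/-- Terms over the object symbols in `α`, with `n` bound object symbols in scope. -/
abbrev Tm (L : FirstOrder.Language.{u, v}) (α : Type w) (n : ℕ) : Type (max u w) := L.Term (α ⊕ Fin n)

/-- Predicate symbols (with their arity). -/
abbrev Pred (L : FirstOrder.Language.{u, v}) : Type v := Σ k : ℕ, L.Relations k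

/-- The object symbol `x` as a term. -/
def Tm.obj {L : FirstOrder.Language.{u, v}} {α : Type w} {n : ℕ} (x : α) : Tm L α n :=
  FirstOrder.Language.Term.var (Sum.inl x)

/-- The `i`-th bound object symbol as a term. -/
def Tm.bd {L : FirstOrder.Language.{u, v}} {α : Type w} {n : ℕ} (i : Fin n) : Tm L α n :=
  FirstOrder.Language.Term.var (Sum.inr i)

/-- The set of (free) object symbols occurring in a term. -/
def Tm.objs {L : FirstOrder.Language.{u, v}} {α : Type w} {n : ℕ} : Tm L α n → Set α
  | FirstOrder.Language.Term.var (Sum.inl x) => {x}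
  | FirstOrder.Language.Term.var (Sum.inr _) => ∅
  | FirstOrder.Language.Term.func _ ts => ⋃ i, Tm.objs (ts i)

/-- Simultaneous substitutions: every object symbol and every bound symbol in scope is mapped to
a term. -/
abbrev Sub (L : FirstOrder.Language.{u, v}) (α : Type w) (n m : ℕ) : Type (max u w) := α ⊕ Fin n → Tm L α m

/-- The extension of a substitution to the scope of one more quantifier, whose bound symbol is the
last index and is mapped to itself. -/
def Sub.lift {L : FirstOrder.Language.{u, v}} {α : Type w} {n m : ℕ} (σ : Sub L α n m) :
    Sub L α (n + 1) (m + 1) :=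
  Sum.elim
    (fun x => (σ (Sum.inl x)).relabel (Sum.map id Fin.castSucc))
    (Fin.lastCases (Tm.bd (Fin.last m))
      (fun i => (σ (Sum.inr i)).relabel (Sum.map id Fin.castSucc)))

/-- The extension of a substitution to the scope of `k` more quantifiers. -/
def Sub.liftN {L : FirstOrder.Language.{u, v}} {α : Type w} {n m : ℕ} (σ : Sub L α n m) :
    (k : ℕ) → Sub L α (n + k) (m + k)
  | 0 => σ
  | k + 1 => (Sub.liftN σ k).lift

/-- First-order formulas. -/
inductive FO (L : FirstOrder.Language.{u, v}) (α : Type w) : ℕ → Type (max u v w)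
  | verum {n : ℕ} : FO L α n
  | falsum {n : ℕ} : FO L α n
  | equal {n : ℕ} (t s : Tm L α n) : FO L α n
  | rel {n k : ℕ} (P : L.Relations k) (ts : Fin k → Tm L α n) : FO L α n
  | neg {n : ℕ} (φ : FO L α n) : FO L α n
  | and {n : ℕ} (φ ψ : FO L α n) : FO L α n
  | or {n : ℕ} (φ ψ : FO L α n) : FO L α n
  | imp {n : ℕ} (φ ψ : FO L α n) : FO L α n
  | iff {n : ℕ} (φ ψ : FO L α n) : FO L α n
  | all {n : ℕ} (φ : FO L α (n + 1)) : FO L α n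
  | ex {n : ℕ} (φ : FO L α (n + 1)) : FO L α n

namespace FO

variable {L : FirstOrder.Language.{u, v}} {α : Type w}

/-- Capture-avoiding simultaneous substitution. -/
def subst : {n m : ℕ} → FO L α n → Sub L α n m → FO L α m
  | _, _, verum, _ => verum
  | _, _, falsum, _ => falsum
  | _, _, equal t s, σ => equal (t.subst σ) (s.subst σ)
  | _, _, rel P ts, σ => rel P (fun i => (ts i).subst σ)
  | _, _, neg φ, σ => neg (φ.subst σ)
  | _, _, and φ ψ, σ => and (φ.subst σ) (ψ.subst σ)
  | _, _, or φ ψ, σ => or (φ.subst σ) (ψ.subst σ)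
  | _, _, imp φ ψ, σ => imp (φ.subst σ) (ψ.subst σ)
  | _, _, iff φ ψ, σ => iff (φ.subst σ) (ψ.subst σ)
  | _, _, all φ, σ => all (φ.subst σ.lift)
  | _, _, ex φ, σ => ex (φ.subst σ.lift)

/-- The set of object symbols occurring freely in a formula. -/
def objs : {n : ℕ} → FO L α n → Set α
  | _, verum => ∅
  | _, falsum => ∅
  | _, equal t s => t.objs ∪ s.objs
  | _, rel _ ts => ⋃ i, (ts i).objs
  | _, neg φ => φ.objs
  | _, and φ ψ => φ.objs ∪ ψ.objs
  | _, or φ ψ => φ.objs ∪ ψ.objs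
  | _, imp φ ψ => φ.objs ∪ ψ.objs
  | _, iff φ ψ => φ.objs ∪ ψ.objs
  | _, all φ => φ.objs
  | _, ex φ => φ.objs

/-- `φ.app s` is the formula `φ[s₁, ..., sₖ]`, where `φ` has the `k` place holders `0, ..., k - 1`. -/
def app {k n : ℕ} (φ : FO L α k) (s : Fin k → Tm L α n) : FO L α n :=
  φ.subst (Sum.elim Tm.obj s)

/-- `φ.occ true` is the set of predicate symbols that occur positively in `φ`, and `φ.occ false` the
set of those that occur negatively in `φ`; the two sides of `⇔` count as both, since
`φ ⇔ ψ` unwinds to `(¬φ ∨ ψ) ∧ (¬ψ ∨ φ)`. -/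
def occ : {n : ℕ} → Bool → FO L α n → Set (Pred L)
  | _, _, verum => ∅
  | _, _, falsum => ∅
  | _, _, equal _ _ => ∅
  | _, true, rel P _ => {⟨_, P⟩}
  | _, false, rel _ _ => ∅
  | _, b, neg φ => φ.occ (!b)
  | _, b, and φ ψ => φ.occ b ∪ ψ.occ b
  | _, b, or φ ψ => φ.occ b ∪ ψ.occ b
  | _, b, imp φ ψ => φ.occ (!b) ∪ ψ.occ b
  | _, b, iff φ ψ => (φ.occ b ∪ φ.occ (!b)) ∪ (ψ.occ b ∪ ψ.occ (!b))
  | _, b, all φ => φ.occ b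
  | _, b, ex φ => φ.occ b

/-- The set of predicate symbols that occur in a formula. -/
def preds {n : ℕ} (φ : FO L α n) : Set (Pred L) := φ.occ true ∪ φ.occ false

open Classical in
/-- `φ.repl Π F true` is `φ[F_Π / Π⁺]`: every positive occurrence of an atom `R(u)` with `R ∈ Π` is
replaced by `F_R[u]`.  Likewise, `φ.repl Π F false` replaces the negative occurrences.  An equivalence
is unwound into two implications. -/
noncomputable def repl (Ps : Set (Pred L)) (F : (Q : Pred L) → FO L α Q.1) :
    {n : ℕ} → Bool → FO L α n → FO L α n
  | _, _, verum => verum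
  | _, _, falsum => falsum
  | _, _, equal t s => equal t s
  | _, true, @rel _ _ _ k P ts =>
      if (⟨k, P⟩ : Pred L) ∈ Ps then (F ⟨k, P⟩).app ts else rel P ts
  | _, false, rel P ts => rel P ts
  | _, b, neg φ => neg (φ.repl Ps F (!b))
  | _, b, and φ ψ => and (φ.repl Ps F b) (ψ.repl Ps F b)
  | _, b, or φ ψ => or (φ.repl Ps F b) (ψ.repl Ps F b)
  | _, b, imp φ ψ => imp (φ.repl Ps F (!b)) (ψ.repl Ps F b)
  | _, b, iff φ ψ =>
      and (imp (φ.repl Ps F (!b)) (ψ.repl Ps F b)) (imp (ψ.repl Ps F (!b)) (φ.repl Ps F b))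
  | _, b, all φ => all (φ.repl Ps F b)
  | _, b, ex φ => ex (φ.repl Ps F b)

/-- Universal closure over all bound symbols in scope: `∀ y₁ ... yₙ : φ`. -/
def alls : {n : ℕ} → FO L α n → FO L α 0
  | 0, φ => φ
  | _ + 1, φ => alls (all φ)

/-- The formula `∀ ȳ : Q(ȳ) ∨ ¬ Q(ȳ)`. -/
def excludedMiddle (Q : Pred L) : FO L α 0 :=
  alls (or (rel Q.2 Tm.bd) (neg (rel Q.2 Tm.bd)))

/-- Atoms: `P(t̄)`, `t = s`, `⊤` and `⊥`. -/
inductive IsAtom {n : ℕ} : FO L α n → Prop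
  | verum : IsAtom verum
  | falsum : IsAtom falsum
  | equal (t s : Tm L α n) : IsAtom (equal t s)
  | rel {k : ℕ} (P : L.Relations k) (ts : Fin k → Tm L α n) : IsAtom (rel P ts)

/-- Formulas composed of literals (atoms and negated atoms) by conjunctions and disjunctions. -/
inductive IsLiteralCombination {n : ℕ} : FO L α n → Prop
  | pos {φ : FO L α n} : IsAtom φ → IsLiteralCombination φ
  | neg {φ : FO L α n} : IsAtom φ → IsLiteralCombination (neg φ)
  | and {φ ψ : FO L α n} :
      IsLiteralCombination φ → IsLiteralCombination ψ → IsLiteralCombination (and φ ψ)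
  | or {φ ψ : FO L α n} :
      IsLiteralCombination φ → IsLiteralCombination ψ → IsLiteralCombination (or φ ψ)

end FO

/-- Definitional rules `∀ x̄ : P(t̄) ← φ`, where `x̄` has length `bound` and `P` has arity `arity`. -/
structure DefRule (L : FirstOrder.Language.{u, v}) (α : Type w) (n : ℕ) : Type (max u v w) where
  bound : ℕ
  arity : ℕ
  head : L.Relations arity
  args : Fin arity → Tm L α (n + bound)
  body : FO L α (n + bound)

namespace DefRule

variable {L : FirstOrder.Language.{u, v}} {α : Type w}

/-- The predicate symbol in the head. -/
def headPred {n : ℕ} (r : DefRule L α n) : Pred L := ⟨r.arity, r.head⟩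

def subst {n m : ℕ} (r : DefRule L α n) (σ : Sub L α n m) : DefRule L α m where
  bound := r.bound
  arity := r.arity
  head := r.head
  args i := (r.args i).subst (σ.liftN r.bound)
  body := r.body.subst (σ.liftN r.bound)

def objs {n : ℕ} (r : DefRule L α n) : Set α := (⋃ i, (r.args i).objs) ∪ r.body.objs

/-- The substitution `[s̄ / x̄]` for the symbols `x̄` bound by a rule. -/
def instSub {k : ℕ} (s : Fin k → Tm L α 0) : Sub L α (0 + k) 0 :=
  Sum.elim Tm.obj (fun i => s (Fin.cast (Nat.zero_add k) i))

/-- The tuple `t̄[s̄ / x̄]`. -/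
def instArgs (r : DefRule L α 0) (s : Fin r.bound → Tm L α 0) (i : Fin r.arity) : Tm L α 0 :=
  (r.args i).subst (instSub s)

/-- The formula `φ[s̄ / x̄]`. -/
def instBody (r : DefRule L α 0) (s : Fin r.bound → Tm L α 0) : FO L α 0 :=
  r.body.subst (instSub s)

end DefRule

/-- Definitions: finite sets of definitional rules. -/
abbrev Defn (L : FirstOrder.Language.{u, v}) (α : Type w) (n : ℕ) : Type (max u v w) := Finset (DefRule L α n)

namespace Defn

variable {L : FirstOrder.Language.{u, v}} {α : Type w}

open Classical in
noncomputable def subst {n m : ℕ} (Φ : Defn L α n) (σ : Sub L α n m) : Defn L α m :=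
  Finset.image (fun r => r.subst σ) Φ

def objs {n : ℕ} (Φ : Defn L α n) : Set α := ⋃ r ∈ Φ, r.objs

/-- The defined predicates. -/
def defined {n : ℕ} (Φ : Defn L α n) : Set (Pred L) := {P | ∃ r ∈ Φ, r.headPred = P}

/-- The predicate symbols among the parameters: those that occur in the definition without being
defined by it. -/
def params {n : ℕ} (Φ : Defn L α n) : Set (Pred L) :=
  {P | (∃ r ∈ Φ, P ∈ r.body.preds) ∧ P ∉ Defn.defined Φ}

/-- The predicate symbols that occur negatively in the body of some rule. -/
def negative {n : ℕ} (Φ : Defn L α n) : Set (Pred L) := {Q | ∃ r ∈ Φ, Q ∈ r.body.occ false}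

/-- `ℓ` is a stratification (only its values on the defined predicates matter). -/
def IsStratification {n : ℕ} (Φ : Defn L α n) (lev : Pred L → ℕ) : Prop :=
  ∀ r ∈ Φ, ∀ Q ∈ Defn.defined Φ,
    (Q ∈ r.body.preds → lev Q ≤ lev r.headPred) ∧
    (Q ∈ r.body.occ false → lev Q < lev r.headPred)

def Stratified {n : ℕ} (Φ : Defn L α n) : Prop := ∃ lev : Pred L → ℕ, Defn.IsStratification Φ lev

end Defn

/-- FO(ID)-formulas: built from atoms and definitions by connectives and quantifiers. -/
inductive FOID (L : FirstOrder.Language.{u, v}) (α : Type w) : ℕ → Type (max u v w)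
  | verum {n : ℕ} : FOID L α n
  | falsum {n : ℕ} : FOID L α n
  | equal {n : ℕ} (t s : Tm L α n) : FOID L α n
  | rel {n k : ℕ} (P : L.Relations k) (ts : Fin k → Tm L α n) : FOID L α n
  | defn {n : ℕ} (Φ : Defn L α n) : FOID L α n
  | neg {n : ℕ} (φ : FOID L α n) : FOID L α n
  | and {n : ℕ} (φ ψ : FOID L α n) : FOID L α n
  | or {n : ℕ} (φ ψ : FOID L α n) : FOID L α n
  | imp {n : ℕ} (φ ψ : FOID L α n) : FOID L α n
  | iff {n : ℕ} (φ ψ : FOID L α n) : FOID L α n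
  | all {n : ℕ} (φ : FOID L α (n + 1)) : FOID L α n
  | ex {n : ℕ} (φ : FOID L α (n + 1)) : FOID L α n

/-- First-order formulas as FO(ID)-formulas. -/
def FO.toFOID {L : FirstOrder.Language.{u, v}} {α : Type w} : {n : ℕ} → FO L α n → FOID L α n
  | _, FO.verum => FOID.verum
  | _, FO.falsum => FOID.falsum
  | _, FO.equal t s => FOID.equal t s
  | _, FO.rel P ts => FOID.rel P ts
  | _, FO.neg φ => FOID.neg φ.toFOID
  | _, FO.and φ ψ => FOID.and φ.toFOID ψ.toFOID
  | _, FO.or φ ψ => FOID.or φ.toFOID ψ.toFOID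
  | _, FO.imp φ ψ => FOID.imp φ.toFOID ψ.toFOID
  | _, FO.iff φ ψ => FOID.iff φ.toFOID ψ.toFOID
  | _, FO.all φ => FOID.all φ.toFOID
  | _, FO.ex φ => FOID.ex φ.toFOID

namespace FOID

variable {L : FirstOrder.Language.{u, v}} {α : Type w}

/-- Capture-avoiding simultaneous substitution. -/
noncomputable def subst : {n m : ℕ} → FOID L α n → Sub L α n m → FOID L α m
  | _, _, verum, _ => verum
  | _, _, falsum, _ => falsum
  | _, _, equal t s, σ => equal (t.subst σ) (s.subst σ)
  | _, _, rel P ts, σ => rel P (fun i => (ts i).subst σ)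
  | _, _, defn Φ, σ => defn (Defn.subst Φ σ)
  | _, _, neg φ, σ => neg (φ.subst σ)
  | _, _, and φ ψ, σ => and (φ.subst σ) (ψ.subst σ)
  | _, _, or φ ψ, σ => or (φ.subst σ) (ψ.subst σ)
  | _, _, imp φ ψ, σ => imp (φ.subst σ) (ψ.subst σ)
  | _, _, iff φ ψ, σ => iff (φ.subst σ) (ψ.subst σ)
  | _, _, all φ, σ => all (φ.subst σ.lift)
  | _, _, ex φ, σ => ex (φ.subst σ.lift)

/-- The set of object symbols occurring freely in a formula. -/
def objs : {n : ℕ} → FOID L α n → Set α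
  | _, verum => ∅
  | _, falsum => ∅
  | _, equal t s => t.objs ∪ s.objs
  | _, rel _ ts => ⋃ i, (ts i).objs
  | _, defn Φ => Defn.objs Φ
  | _, neg φ => φ.objs
  | _, and φ ψ => φ.objs ∪ ψ.objs
  | _, or φ ψ => φ.objs ∪ ψ.objs
  | _, imp φ ψ => φ.objs ∪ ψ.objs
  | _, iff φ ψ => φ.objs ∪ ψ.objs
  | _, all φ => φ.objs
  | _, ex φ => φ.objs

/-- `φ.inst t` is `φ[t / x]`, where `x` is the symbol bound by the quantifier in `∀ x : φ` or
`∃ x : φ`. -/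
noncomputable def inst (φ : FOID L α 1) (t : Tm L α 0) : FOID L α 0 :=
  φ.subst (Sum.elim Tm.obj (fun _ => t))

open Classical in
/-- `φ.repl₁ x t` is `φ[t / x]`, for an object symbol `x`. -/
noncomputable def repl₁ (x : α) (t : Tm L α 0) (φ : FOID L α 0) : FOID L α 0 :=
  φ.subst (Sum.elim (fun z => if z = x then t else Tm.obj z) Tm.bd)

open Classical in
/-- `φ.repl₂ x t y s` is `φ[t / x, s / y]`, for distinct object symbols `x` and `y`. -/
noncomputable def repl₂ (x : α) (t : Tm L α 0) (y : α) (s : Tm L α 0) (φ : FOID L α 0) :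
    FOID L α 0 :=
  φ.subst (Sum.elim (fun z => if z = x then t else if z = y then s else Tm.obj z) Tm.bd)

/-- `free(Γ)`: the object symbols occurring freely in some formula in `Γ`. -/
def free (Γ : Set (FOID L α 0)) : Set α := ⋃ φ ∈ Γ, φ.objs

end FOID

/-! ### The sequent calculus -/

open FOID in
/-- `Derives C Γ Δ`: the sequent `Γ ⊢ Δ` (where `Γ` and `Δ` are sets of FO(ID)-formulas) has a proof in
the sequent calculus for FO(ID) in which every cut formula belongs to `C`. -/
inductive Derives {L : FirstOrder.Language.{u, v}} {α : Type w} (C : Set (FOID L α 0)) :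
    Set (FOID L α 0) → Set (FOID L α 0) → Prop
  -- structural rules
  | ax {Γ Δ : Set (FOID L α 0)} :
      ((Γ ∩ Δ).Nonempty ∨ falsum ∈ Γ ∨ verum ∈ Δ) → Derives C Γ Δ
  | wk {Γ Δ Γ' Δ' : Set (FOID L α 0)} : Γ' ⊆ Γ → Δ' ⊆ Δ → Derives C Γ' Δ' → Derives C Γ Δ
  | subst {Γ Δ : Set (FOID L α 0)} (x : α) (t : Tm L α 0) :
      Derives C Γ Δ → Derives C (repl₁ x t '' Γ) (repl₁ x t '' Δ)
  | cut {Γ Δ : Set (FOID L α 0)} (φ : FOID L α 0) : φ ∈ C →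
      Derives C Γ (insert φ Δ) → Derives C (insert φ Γ) Δ → Derives C Γ Δ
  -- logical rules
  | negL {Γ Δ : Set (FOID L α 0)} {φ : FOID L α 0} :
      Derives C Γ (insert φ Δ) → Derives C (insert (neg φ) Γ) Δ
  | negR {Γ Δ : Set (FOID L α 0)} {φ : FOID L α 0} :
      Derives C (insert φ Γ) Δ → Derives C Γ (insert (neg φ) Δ)
  | orL {Γ Δ : Set (FOID L α 0)} {φ ψ : FOID L α 0} :
      Derives C (insert φ Γ) Δ → Derives C (insert ψ Γ) Δ → Derives C (insert (or φ ψ) Γ) Δ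
  | orR {Γ Δ : Set (FOID L α 0)} {φ ψ : FOID L α 0} :
      Derives C Γ (insert φ (insert ψ Δ)) → Derives C Γ (insert (or φ ψ) Δ)
  | andL {Γ Δ : Set (FOID L α 0)} {φ ψ : FOID L α 0} :
      Derives C (insert φ (insert ψ Γ)) Δ → Derives C (insert (and φ ψ) Γ) Δ
  | andR {Γ Δ : Set (FOID L α 0)} {φ ψ : FOID L α 0} :
      Derives C Γ (insert φ Δ) → Derives C Γ (insert ψ Δ) → Derives C Γ (insert (and φ ψ) Δ)
  | impL {Γ Δ : Set (FOID L α 0)} {φ ψ : FOID L α 0} :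
      Derives C Γ (insert φ Δ) → Derives C (insert ψ Γ) Δ → Derives C (insert (imp φ ψ) Γ) Δ
  | impR {Γ Δ : Set (FOID L α 0)} {φ ψ : FOID L α 0} :
      Derives C (insert φ Γ) (insert ψ Δ) → Derives C Γ (insert (imp φ ψ) Δ)
  | iffL {Γ Δ : Set (FOID L α 0)} {φ ψ : FOID L α 0} :
      Derives C Γ (insert φ (insert ψ Δ)) → Derives C (insert φ (insert ψ Γ)) Δ →
      Derives C (insert (iff φ ψ) Γ) Δ
  | iffR {Γ Δ : Set (FOID L α 0)} {φ ψ : FOID L α 0} :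
      Derives C (insert φ Γ) (insert ψ Δ) → Derives C (insert ψ Γ) (insert φ Δ) →
      Derives C Γ (insert (iff φ ψ) Δ)
  | allL {Γ Δ : Set (FOID L α 0)} {φ : FOID L α 1} (t : Tm L α 0) :
      Derives C (insert (φ.inst t) Γ) Δ → Derives C (insert (all φ) Γ) Δ
  | allR {Γ Δ : Set (FOID L α 0)} {φ : FOID L α 1} (x : α) :
      x ∉ free Γ → x ∉ free Δ → x ∉ φ.objs →
      Derives C Γ (insert (φ.inst (Tm.obj x)) Δ) → Derives C Γ (insert (all φ) Δ)
  | exL {Γ Δ : Set (FOID L α 0)} {φ : FOID L α 1} (x : α) :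
      x ∉ free Γ → x ∉ free Δ → x ∉ φ.objs →
      Derives C (insert (φ.inst (Tm.obj x)) Γ) Δ → Derives C (insert (ex φ) Γ) Δ
  | exR {Γ Δ : Set (FOID L α 0)} {φ : FOID L α 1} (t : Tm L α 0) :
      Derives C Γ (insert (φ.inst t) Δ) → Derives C Γ (insert (ex φ) Δ)
  | eqL {Γ Δ : Set (FOID L α 0)} (x y : α) (t s : Tm L α 0) : x ≠ y →
      Derives C (repl₂ x s y t '' Γ) (repl₂ x s y t '' Δ) →
      Derives C (insert (equal t s) (repl₂ x t y s '' Γ)) (repl₂ x t y s '' Δ)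
  | eqR {Γ Δ : Set (FOID L α 0)} (t : Tm L α 0) : Derives C Γ (insert (equal t t) Δ)
  -- rules for defined atoms
  | defR {Γ Δ : Set (FOID L α 0)} (Φ : Defn L α 0) (r : DefRule L α 0) (s : Fin r.bound → Tm L α 0) :
      r ∈ Φ →
      Derives C (insert (defn Φ) Γ) (insert (r.instBody s).toFOID Δ) →
      Derives C (insert (defn Φ) Γ) (insert (rel r.head (r.instArgs s)) Δ)
  /- The induction rule: `F Q` is the induction hypothesis for `Q`, and `ys r` names the symbols that
  are bound by the rule `r`. -/
  | defL {Γ Δ : Set (FOID L α 0)} (Φ : Defn L α 0) (Ps : Set (Pred L))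
      (F : (Q : Pred L) → FO L α Q.1) (ys : (r : DefRule L α 0) → Fin r.bound → α)
      (P : Pred L) (ts : Fin P.1 → Tm L α 0) :
      Ps ⊆ Defn.defined Φ → P ∈ Ps →
      (∀ r ∈ Φ, Function.Injective (ys r)) →
      (∀ r ∈ Φ, ∀ i, ys r i ∉ free Γ ∧ ys r i ∉ free Δ ∧ ys r i ∉ Defn.objs Φ ∧
        ∀ Q ∈ Ps, ys r i ∉ (F Q).objs) →
      (∀ r ∈ Φ, r.headPred ∈ Ps →
        Derives C
          (insert ((r.instBody (fun i => Tm.obj (ys r i))).repl Ps F true).toFOID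
            (insert (defn Φ) Γ))
          (insert ((F r.headPred).app (r.instArgs (fun i => Tm.obj (ys r i)))).toFOID Δ)) →
      Derives C (insert ((F P).app ts).toFOID (insert (defn Φ) Γ)) Δ →
      Derives C (insert (rel P.2 ts) (insert (defn Φ) Γ)) Δ

/-- Provability: arbitrary cut formulas are allowed. -/
def Provable {L : FirstOrder.Language.{u, v}} {α : Type w} (Γ Δ : Set (FOID L α 0)) : Prop :=
  Derives Set.univ Γ Δ

/-! ### Canonical sequents -/

/-- The left-hand side of the regular sequent `Γ, Φ₁, ..., Φₙ ⊢ Δ`. -/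
def antecedent {L : FirstOrder.Language.{u, v}} {α : Type w} {n : ℕ} (Γ : Set (FO L α 0))
    (Φ : Fin n → Defn L α 0) : Set (FOID L α 0) :=
  FO.toFOID '' Γ ∪ Set.range (fun i => FOID.defn (Φ i))

/-- The right-hand side of the regular sequent `Γ, Φ₁, ..., Φₙ ⊢ Δ`. -/
def succedent {L : FirstOrder.Language.{u, v}} {α : Type w} (Δ : Set (FO L α 0)) : Set (FOID L α 0) :=
  FO.toFOID '' Δ

/-- The regular sequent `Γ, Φ₁, ..., Φₙ ⊢ Δ` is canonical. -/
structure Canonical {L : FirstOrder.Language.{u, v}} {α : Type w} {n : ℕ} (Γ : Set (FO L α 0))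
    (Φ : Fin n → Defn L α 0) (Δ : Set (FO L α 0)) : Prop where
  finite_left : Γ.Finite
  finite_right : Δ.Finite
  bodies : ∀ i, ∀ r ∈ Φ i, r.body.IsLiteralCombination
  defined_disjoint : ∀ i j, i ≠ j → Disjoint (Defn.defined (Φ i)) (Defn.defined (Φ j))
  defined_params : ∀ i j, j < i → Disjoint (Defn.defined (Φ i)) (Defn.params (Φ j))

/-- The formulas on which elementary cuts may be made: `∀ ȳ : Q(ȳ) ∨ ¬ Q(ȳ)`, where `Q` occurs
negatively in the body of a rule of some `Φᵢ`. -/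
def elementaryCuts {L : FirstOrder.Language.{u, v}} {α : Type w} {n : ℕ} (Φ : Fin n → Defn L α 0) :
    Set (FOID L α 0) :=
  {χ | ∃ i, ∃ Q ∈ Defn.negative (Φ i), χ = (FO.excludedMiddle Q).toFOID}

/-- The sequent `Γ, Φ₁, ..., Φₙ ⊢ Δ` is provable with elementary cuts. -/
def ProvableWithElementaryCuts {L : FirstOrder.Language.{u, v}} {α : Type w} {n : ℕ} (Γ : Set (FO L α 0))
    (Φ : Fin n → Defn L α 0) (Δ : Set (FO L α 0)) : Prop :=
  Derives (elementaryCuts Φ) (antecedent Γ Φ) (succedent Δ)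

end SCFOID

/-! Cuts are eliminated semantically, by forcing. Suppose the sequent has no proof with cut formulas
from a set `C'`. Take as conditions all finite sequents that are underivable with cuts from `C'` and
contain the given definitions on the left; extending a sequent strengthens the condition. Formulas
are valued in the regular sets of conditions, over the universe of all terms. The calculus with
arbitrary cuts is sound for every such valuation (`Derives.holds`), because regular sets validate
classical logic. It then suffices to find an interpretation in which the underivable sequent, as a
condition, forces its own left side and refutes its own right side.

Without cut, the place of a formula in a sequent only bounds its value: a condition with the formula
on the left must force it, and one with the formula on the right must not. Interpretations of atoms
that respect these bounds are called candidates (`IsCandidate`). The logical rules carry the bounds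
from atoms to all first-order formulas (`FO.truth`). Equality of two terms is interpreted as their
exchangeability in succedents of derivable sequents (`condEq`).

Defined predicates need candidates that satisfy their definitions. They are built by recursion on a
well-founded rank: one block of predicates of equal rank is interpreted by the least family closed
under its rules, obtained impredicatively as an intersection over all closed families of candidates
of formulas. Since negative occurrences have strictly lower rank, bodies are monotone in the block
and the intersection is again closed (`closed_interp`). The rule (def L) shows that the intersection
is large enough to be a candidate (`mem_of_closed`); the rule (def R) shows that heads of forced
bodies stay within the upper bound (`mem_largest_of_body`). By the truth lemma, every first-order
induction hypothesis is itself a candidate, so minimality yields the induction principle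
(`induction_interp`) and every condition forces the definitions.

Stratifications and the ordering of the definitions in a canonical sequent supply the rank
(`Canonical.isRanked`). The set `C'` is arbitrary, even empty, so elementary cuts are only a special
case. -/

namespace SCFOID

open FirstOrder.Language (Term)

section Substitution

variable {L : FirstOrder.Language.{u, v}} {α : Type w}

/-! ### Substitutions -/

/-- Composition of substitutions: first `σ`, then `τ`. -/
def Sub.comp {n m k : ℕ} (σ : Sub L α n m) (τ : Sub L α m k) : Sub L α n k :=
  fun a => (σ a).subst τ

/-- The identity substitution. -/
def Sub.ident (L : FirstOrder.Language.{u, v}) (α : Type w) (n : ℕ) : Sub L α n n :=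
  Term.var

/-- Extension of a substitution by a value for one more bound symbol. -/
def Sub.snoc {n m : ℕ} (σ : Sub L α n m) (t : Tm L α m) : Sub L α (n + 1) m :=
  Sum.elim (fun x => σ (Sum.inl x)) (Fin.lastCases t (fun i => σ (Sum.inr i)))

/-- Extension of a substitution by values for `k` more bound symbols. -/
def Sub.append {n m k : ℕ} (σ : Sub L α n m) (s : Fin k → Tm L α m) : Sub L α (n + k) m :=
  Sum.elim (fun x => σ (Sum.inl x)) (Fin.addCases (fun i => σ (Sum.inr i)) s)

section terms

variable {n m k : ℕ}

@[simp] theorem subst_obj (x : α) (σ : Sub L α n m) :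
    Term.subst (Tm.obj x : Tm L α n) σ = σ (Sum.inl x) := rfl

@[simp] theorem subst_bd (i : Fin n) (σ : Sub L α n m) :
    Term.subst (Tm.bd i : Tm L α n) σ = σ (Sum.inr i) := rfl

theorem Tm.subst_subst (t : Tm L α n) (σ : Sub L α n m) (τ : Sub L α m k) :
    (t.subst σ).subst τ = t.subst (σ.comp τ) := by
  induction t with
  | var a => rfl
  | func f ts ih => simp [Term.subst, ih]

theorem Tm.relabel_subst (t : Tm L α n) (g : α ⊕ Fin n → α ⊕ Fin m) (τ : Sub L α m k) :
    (t.relabel g).subst τ = t.subst (fun a => τ (g a)) := by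
  induction t with
  | var a => rfl
  | func f ts ih => simp [Term.subst, Term.relabel, ih]

theorem Tm.subst_relabel (t : Tm L α n) (σ : Sub L α n m) (g : α ⊕ Fin m → α ⊕ Fin k) :
    (t.subst σ).relabel g = t.subst (fun a => (σ a).relabel g) := by
  induction t with
  | var a => rfl
  | func f ts ih => simp [Term.subst, Term.relabel, ih]

theorem Tm.subst_id (t : Tm L α n) : t.subst (Sub.ident L α n) = t := by
  induction t with
  | var a => rfl
  | func f ts ih => simp [Term.subst, ih]

theorem Tm.subst_congr (t : Tm L α n) (σ τ : Sub L α n m)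
    (h : ∀ x ∈ t.objs, σ (Sum.inl x) = τ (Sum.inl x))
    (h' : ∀ i, σ (Sum.inr i) = τ (Sum.inr i)) : t.subst σ = t.subst τ := by
  induction t with
  | var a =>
    rcases a with x | i
    · exact h x (by simp [Tm.objs])
    · exact h' i
  | func f ts ih =>
    simp only [Term.subst, Term.func.injEq, heq_eq_eq, true_and]
    funext i
    exact ih i (fun x hx => h x (by simp only [Tm.objs, Set.mem_iUnion]; exact ⟨i, hx⟩))

theorem Tm.objs_finite (t : Tm L α n) : t.objs.Finite := by
  induction t with
  | var a => rcases a with x | i <;> simp [Tm.objs]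
  | func f ts ih => simpa only [Tm.objs] using Set.finite_iUnion ih

end terms

theorem Sub.comp_id {n m : ℕ} (σ : Sub L α n m) : σ.comp (Sub.ident L α m) = σ :=
  funext fun _ => Tm.subst_id _

theorem Sub.lift_comp {n m k : ℕ} (σ : Sub L α n m) (τ : Sub L α m k) :
    σ.lift.comp τ.lift = (σ.comp τ).lift := by
  have key : (fun a => τ.lift (Sum.map id Fin.castSucc a)) =
      fun a => (τ a).relabel (Sum.map id Fin.castSucc) := by
    funext a
    rcases a with x | i <;> simp [Sub.lift]
  funext a
  rcases a with x | i
  · simp only [Sub.comp, Sub.lift, Sum.elim_inl]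
    rw [Tm.relabel_subst, Tm.subst_relabel]
    exact congrArg _ key
  · refine Fin.lastCases ?_ (fun i => ?_) i
    · simp [Sub.comp, Sub.lift]
    · simp only [Sub.comp, Sub.lift, Sum.elim_inr, Fin.lastCases_castSucc]
      rw [Tm.relabel_subst, Tm.subst_relabel]
      exact congrArg _ key

theorem Sub.lift_id (n : ℕ) : (Sub.ident L α n).lift = Sub.ident L α (n + 1) := by
  funext a
  rcases a with x | i
  · rfl
  · refine Fin.lastCases ?_ (fun i => ?_) i <;> simp [Sub.lift, Sub.ident, Tm.bd]

theorem Sub.lift_comp_snoc {n m k : ℕ} (σ : Sub L α n m) (τ : Sub L α m k) (t : Tm L α k) :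
    σ.lift.comp (τ.snoc t) = (σ.comp τ).snoc t := by
  have key : (fun a => τ.snoc t (Sum.map id Fin.castSucc a)) = τ := by
    funext a
    rcases a with x | i <;> simp [Sub.snoc]
  funext a
  rcases a with x | i
  · simp only [Sub.comp, Sub.lift, Sub.snoc, Sum.elim_inl]
    rw [Tm.relabel_subst]
    exact congrArg _ key
  · refine Fin.lastCases ?_ (fun i => ?_) i
    · simp [Sub.comp, Sub.lift, Sub.snoc]
    · simp only [Sub.comp, Sub.lift, Sub.snoc, Sum.elim_inr, Fin.lastCases_castSucc]
      rw [Tm.relabel_subst]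
      exact congrArg _ key

theorem Sub.append_zero {n m : ℕ} (σ : Sub L α n m) (s : Fin 0 → Tm L α m) :
    (σ.append s : Sub L α (n + 0) m) = σ := by
  funext a
  rcases a with x | i
  · rfl
  · change Fin.addCases (fun i => σ (Sum.inr i)) s (Fin.castAdd 0 i) = σ (Sum.inr i)
    rw [Fin.addCases_left]

theorem Sub.append_succ {n m l : ℕ} (σ : Sub L α n m) (s : Fin (l + 1) → Tm L α m) :
    (σ.append s : Sub L α (n + (l + 1)) m) =
      (σ.append (fun i => s i.castSucc)).snoc (s (Fin.last l)) := by
  funext a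
  rcases a with x | i
  · rfl
  · refine Fin.lastCases (n := n + l) ?_ (fun i => ?_) i
    · have : Fin.last (n + l) = Fin.natAdd n (Fin.last l) := rfl
      simp only [Sub.append, Sub.snoc, Sum.elim_inr, Fin.lastCases_last]
      rw [this, Fin.addCases_right]
    · refine Fin.addCases (fun i => ?_) (fun i => ?_) i
      · have : (Fin.castAdd l i).castSucc = Fin.castAdd (l + 1) i := rfl
        simp only [Sub.append, Sub.snoc, Sum.elim_inr, Fin.lastCases_castSucc, Fin.addCases_left]
        rw [this, Fin.addCases_left]
      · have : (Fin.natAdd n i).castSucc = Fin.natAdd n i.castSucc := rfl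
        simp only [Sub.append, Sub.snoc, Sum.elim_inr, Fin.lastCases_castSucc, Fin.addCases_right]
        rw [this, Fin.addCases_right]

theorem Sub.liftN_comp_append {n m k l : ℕ} (σ : Sub L α n m) (τ : Sub L α m k)
    (s : Fin l → Tm L α k) :
    (σ.liftN l).comp (τ.append s) = (σ.comp τ).append s := by
  induction l with
  | zero =>
    rw [Sub.append_zero, Sub.append_zero]
    rfl
  | succ l ih =>
    rw [Sub.append_succ, Sub.append_succ, ← ih]
    exact Sub.lift_comp_snoc _ _ _

theorem Sub.lift_congr {n m : ℕ} {σ τ : Sub L α n m} {S : Set α}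
    (h : ∀ x ∈ S, σ (Sum.inl x) = τ (Sum.inl x))
    (h' : ∀ i, σ (Sum.inr i) = τ (Sum.inr i)) :
    (∀ x ∈ S, σ.lift (Sum.inl x) = τ.lift (Sum.inl x)) ∧
      ∀ i, σ.lift (Sum.inr i) = τ.lift (Sum.inr i) := by
  refine ⟨fun x hx => by simp [Sub.lift, h x hx], fun i => ?_⟩
  refine Fin.lastCases ?_ (fun i => ?_) i <;> simp [Sub.lift, h']

theorem Sub.liftN_congr {n m : ℕ} {σ τ : Sub L α n m} {S : Set α}
    (h : ∀ x ∈ S, σ (Sum.inl x) = τ (Sum.inl x))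
    (h' : ∀ i, σ (Sum.inr i) = τ (Sum.inr i)) (k : ℕ) :
    (∀ x ∈ S, σ.liftN k (Sum.inl x) = τ.liftN k (Sum.inl x)) ∧
      ∀ i, σ.liftN k (Sum.inr i) = τ.liftN k (Sum.inr i) := by
  induction k with
  | zero => exact ⟨h, h'⟩
  | succ k ih => exact Sub.lift_congr ih.1 ih.2

theorem Sub.liftN_id (n k : ℕ) : (Sub.ident L α n).liftN k = Sub.ident L α (n + k) := by
  induction k with
  | zero => rfl
  | succ k ih => rw [Sub.liftN, ih, Sub.lift_id]; rfl

/-! ### Substitution in formulas -/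

theorem FO.subst_subst {n m k : ℕ} (φ : FO L α n) (σ : Sub L α n m) (τ : Sub L α m k) :
    (φ.subst σ).subst τ = φ.subst (σ.comp τ) := by
  induction φ generalizing m k with
  | verum => rfl
  | falsum => rfl
  | equal t s => simp [FO.subst, Tm.subst_subst]
  | rel P ts => simp [FO.subst, Tm.subst_subst]
  | neg φ ih => simp [FO.subst, ih]
  | and φ ψ ih ih' => simp [FO.subst, ih, ih']
  | or φ ψ ih ih' => simp [FO.subst, ih, ih']
  | imp φ ψ ih ih' => simp [FO.subst, ih, ih']
  | iff φ ψ ih ih' => simp [FO.subst, ih, ih']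
  | all φ ih => simp [FO.subst, ih, Sub.lift_comp]
  | ex φ ih => simp [FO.subst, ih, Sub.lift_comp]

theorem FO.subst_id {n : ℕ} (φ : FO L α n) : φ.subst (Sub.ident L α n) = φ := by
  induction φ with
  | verum => rfl
  | falsum => rfl
  | equal t s => simp [FO.subst, Tm.subst_id]
  | rel P ts => simp [FO.subst, Tm.subst_id]
  | neg φ ih => simp [FO.subst, ih]
  | and φ ψ ih ih' => simp [FO.subst, ih, ih']
  | or φ ψ ih ih' => simp [FO.subst, ih, ih']
  | imp φ ψ ih ih' => simp [FO.subst, ih, ih']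
  | iff φ ψ ih ih' => simp [FO.subst, ih, ih']
  | all φ ih => simp [FO.subst, ih, Sub.lift_id]
  | ex φ ih => simp [FO.subst, ih, Sub.lift_id]

theorem FO.subst_congr {n m : ℕ} (φ : FO L α n) (σ τ : Sub L α n m)
    (h : ∀ x ∈ φ.objs, σ (Sum.inl x) = τ (Sum.inl x))
    (h' : ∀ i, σ (Sum.inr i) = τ (Sum.inr i)) : φ.subst σ = φ.subst τ := by
  induction φ generalizing m with
  | verum => rfl
  | falsum => rfl
  | equal t s =>
    simp only [FO.subst]
    rw [Tm.subst_congr t σ τ (fun x hx => h x (Or.inl hx)) h',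
      Tm.subst_congr s σ τ (fun x hx => h x (Or.inr hx)) h']
  | rel P ts =>
    simp only [FO.subst]
    congr 1
    funext i
    exact Tm.subst_congr _ σ τ (fun x hx => h x (Set.mem_iUnion.2 ⟨i, hx⟩)) h'
  | neg φ ih => simp only [FO.subst]; rw [ih σ τ h h']
  | and φ ψ ih ih' | or φ ψ ih ih' | imp φ ψ ih ih' | iff φ ψ ih ih' =>
    simp only [FO.subst]
    rw [ih σ τ (fun x hx => h x (Or.inl hx)) h', ih' σ τ (fun x hx => h x (Or.inr hx)) h']
  | all φ ih | ex φ ih =>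
    simp only [FO.subst]
    rw [ih _ _ (Sub.lift_congr h h').1 (Sub.lift_congr h h').2]

theorem FO.objs_finite {n : ℕ} (φ : FO L α n) : φ.objs.Finite := by
  induction φ with
  | verum => exact Set.finite_empty
  | falsum => exact Set.finite_empty
  | equal t s => exact t.objs_finite.union s.objs_finite
  | rel P ts => exact Set.finite_iUnion fun i => (ts i).objs_finite
  | neg φ ih | all φ ih | ex φ ih => exact ih
  | and φ ψ ih ih' | or φ ψ ih ih' | imp φ ψ ih ih' | iff φ ψ ih ih' => exact ih.union ih'

theorem FO.toFOID_subst {n m : ℕ} (φ : FO L α n) (σ : Sub L α n m) :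
    φ.toFOID.subst σ = (φ.subst σ).toFOID := by
  induction φ generalizing m with
  | verum => rfl
  | falsum => rfl
  | equal t s => rfl
  | rel P ts => rfl
  | neg φ ih => simp [FO.subst, FO.toFOID, FOID.subst, ih]
  | and φ ψ ih ih' => simp [FO.subst, FO.toFOID, FOID.subst, ih, ih']
  | or φ ψ ih ih' => simp [FO.subst, FO.toFOID, FOID.subst, ih, ih']
  | imp φ ψ ih ih' => simp [FO.subst, FO.toFOID, FOID.subst, ih, ih']
  | iff φ ψ ih ih' => simp [FO.subst, FO.toFOID, FOID.subst, ih, ih']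
  | all φ ih => simp [FO.subst, FO.toFOID, FOID.subst, ih]
  | ex φ ih => simp [FO.subst, FO.toFOID, FOID.subst, ih]

theorem FO.IsAtom.subst {n m : ℕ} {φ : FO L α n} (h : φ.IsAtom) (σ : Sub L α n m) :
    (φ.subst σ).IsAtom := by
  cases h <;> constructor

theorem FO.IsLiteralCombination.subst {n m : ℕ} {φ : FO L α n} (h : φ.IsLiteralCombination)
    (σ : Sub L α n m) : (φ.subst σ).IsLiteralCombination := by
  induction h with
  | pos h => exact .pos (h.subst σ)
  | neg h => exact .neg (h.subst σ)
  | and _ _ ih ih' => exact .and ih ih'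
  | or _ _ ih ih' => exact .or ih ih'

theorem DefRule.subst_congr {n m : ℕ} (r : DefRule L α n) (σ τ : Sub L α n m)
    (h : ∀ x ∈ r.objs, σ (Sum.inl x) = τ (Sum.inl x))
    (h' : ∀ i, σ (Sum.inr i) = τ (Sum.inr i)) : r.subst σ = r.subst τ := by
  obtain ⟨h1, h2⟩ := Sub.liftN_congr h h' r.bound
  simp only [DefRule.subst, DefRule.mk.injEq, heq_eq_eq, true_and]
  refine ⟨funext fun i => ?_, ?_⟩
  · exact Tm.subst_congr _ _ _ (fun x hx => h1 x (Or.inl (Set.mem_iUnion.2 ⟨i, hx⟩))) h2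
  · exact FO.subst_congr _ _ _ (fun x hx => h1 x (Or.inr hx)) h2

theorem DefRule.subst_id {n : ℕ} (r : DefRule L α n) : r.subst (Sub.ident L α n) = r := by
  simp [DefRule.subst, Sub.liftN_id, Tm.subst_id, FO.subst_id]

theorem DefRule.objs_finite {n : ℕ} (r : DefRule L α n) : r.objs.Finite :=
  (Set.finite_iUnion fun i => (r.args i).objs_finite).union r.body.objs_finite

theorem Defn.subst_congr {n m : ℕ} (Φ : Defn L α n) (σ τ : Sub L α n m)
    (h : ∀ x ∈ Defn.objs Φ, σ (Sum.inl x) = τ (Sum.inl x))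
    (h' : ∀ i, σ (Sum.inr i) = τ (Sum.inr i)) : Defn.subst Φ σ = Defn.subst Φ τ := by
  classical
  unfold Defn.subst
  refine Finset.image_congr fun r hr => ?_
  exact r.subst_congr σ τ (fun x hx => h x (Set.mem_biUnion hr hx)) h'

theorem Defn.subst_id {n : ℕ} (Φ : Defn L α n) : Defn.subst Φ (Sub.ident L α n) = Φ := by
  unfold Defn.subst
  simp [DefRule.subst_id]

theorem Defn.objs_finite {n : ℕ} (Φ : Defn L α n) : (Defn.objs Φ).Finite :=
  Set.Finite.biUnion Φ.finite_toSet fun r _ => r.objs_finite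

theorem Defn.defined_finite {n : ℕ} (Φ : Defn L α n) : (Defn.defined Φ).Finite :=
  Φ.finite_toSet.image DefRule.headPred

theorem Defn.mem_subst {n m : ℕ} (Φ : Defn L α n) (σ : Sub L α n m) (r : DefRule L α m) :
    r ∈ Defn.subst Φ σ ↔ ∃ r' ∈ Φ, r'.subst σ = r := by
  simp [Defn.subst]

theorem Defn.defined_subst {n m : ℕ} (Φ : Defn L α n) (σ : Sub L α n m) :
    Defn.defined (Defn.subst Φ σ) = Defn.defined Φ := by
  ext P
  constructor
  · rintro ⟨r, hr, rfl⟩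
    obtain ⟨r', hr', rfl⟩ := (Defn.mem_subst _ _ _).1 hr
    exact ⟨r', hr', rfl⟩
  · rintro ⟨r, hr, rfl⟩
    exact ⟨r.subst σ, (Defn.mem_subst _ _ _).2 ⟨r, hr, rfl⟩, rfl⟩

theorem FOID.subst_id {n : ℕ} (φ : FOID L α n) : φ.subst (Sub.ident L α n) = φ := by
  induction φ with
  | verum => rfl
  | falsum => rfl
  | equal t s => simp [FOID.subst, Tm.subst_id]
  | rel P ts => simp [FOID.subst, Tm.subst_id]
  | defn Φ => simp [FOID.subst, Defn.subst_id]
  | neg φ ih => simp [FOID.subst, ih]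
  | and φ ψ ih ih' => simp [FOID.subst, ih, ih']
  | or φ ψ ih ih' => simp [FOID.subst, ih, ih']
  | imp φ ψ ih ih' => simp [FOID.subst, ih, ih']
  | iff φ ψ ih ih' => simp [FOID.subst, ih, ih']
  | all φ ih => simp [FOID.subst, ih, Sub.lift_id]
  | ex φ ih => simp [FOID.subst, ih, Sub.lift_id]

theorem FOID.subst_congr {n m : ℕ} (φ : FOID L α n) (σ τ : Sub L α n m)
    (h : ∀ x ∈ φ.objs, σ (Sum.inl x) = τ (Sum.inl x))
    (h' : ∀ i, σ (Sum.inr i) = τ (Sum.inr i)) : φ.subst σ = φ.subst τ := by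
  induction φ generalizing m with
  | verum => rfl
  | falsum => rfl
  | equal t s =>
    simp only [FOID.subst]
    rw [Tm.subst_congr t σ τ (fun x hx => h x (Or.inl hx)) h',
      Tm.subst_congr s σ τ (fun x hx => h x (Or.inr hx)) h']
  | rel P ts =>
    simp only [FOID.subst]
    congr 1
    funext i
    exact Tm.subst_congr _ σ τ (fun x hx => h x (Set.mem_iUnion.2 ⟨i, hx⟩)) h'
  | defn Φ => simp only [FOID.subst]; rw [Defn.subst_congr Φ σ τ h h']
  | neg φ ih => simp only [FOID.subst]; rw [ih σ τ h h']
  | and φ ψ ih ih' | or φ ψ ih ih' | imp φ ψ ih ih' | iff φ ψ ih ih' =>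
    simp only [FOID.subst]
    rw [ih σ τ (fun x hx => h x (Or.inl hx)) h', ih' σ τ (fun x hx => h x (Or.inr hx)) h']
  | all φ ih | ex φ ih =>
    simp only [FOID.subst]
    rw [ih _ _ (Sub.lift_congr h h').1 (Sub.lift_congr h h').2]

theorem FOID.objs_finite {n : ℕ} (φ : FOID L α n) : φ.objs.Finite := by
  induction φ with
  | verum => exact Set.finite_empty
  | falsum => exact Set.finite_empty
  | equal t s => exact t.objs_finite.union s.objs_finite
  | rel P ts => exact Set.finite_iUnion fun i => (ts i).objs_finite
  | defn Φ => exact Defn.objs_finite Φ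
  | neg φ ih | all φ ih | ex φ ih => exact ih
  | and φ ψ ih ih' | or φ ψ ih ih' | imp φ ψ ih ih' | iff φ ψ ih ih' => exact ih.union ih'

theorem FOID.free_finite {Γ : Set (FOID L α 0)} (h : Γ.Finite) : (FOID.free Γ).Finite :=
  h.biUnion fun φ _ => φ.objs_finite

end Substitution

/-! ### Forcing: regular sets of conditions -/

section Regular

variable {K : Type*} [Preorder K]

/-- A set of conditions is regular if it is downward closed and contains every condition below which
it is dense. -/
structure IsRegular (X : Set K) : Prop where
  lower : ∀ {p q : K}, q ≤ p → p ∈ X → q ∈ X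
  dense : ∀ {p : K}, (∀ q ≤ p, ∃ r ≤ q, r ∈ X) → p ∈ X

/-- The conditions that force the negation of `X`. -/
def notS (X : Set K) : Set K := {p | ∀ q ≤ p, q ∉ X}

/-- The conditions that force the implication from `X` to `Y`. -/
def impS (X Y : Set K) : Set K := {p | ∀ q ≤ p, q ∈ X → q ∈ Y}

/-- The conditions that force the disjunction of `X` and `Y`. -/
def orS (X Y : Set K) : Set K := notS (notS X ∩ notS Y)

/-- The conditions that force the disjunction of a family. -/
def exS {ι : Type*} (X : ι → Set K) : Set K := notS (⋂ i, notS (X i))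

variable {X Y : Set K} {p q : K}

theorem notS_lower (h : q ≤ p) (hp : p ∈ notS X) : q ∈ notS X :=
  fun r hr => hp r (hr.trans h)

theorem IsRegular.notS (hX : IsRegular X) : IsRegular (notS X) where
  lower := notS_lower
  dense := fun {p} h q hq hqX => by
    obtain ⟨r, hr, hr'⟩ := h q hq
    exact hr' r le_rfl (hX.lower hr hqX)

theorem isRegular_notS_of_lower (hX : ∀ {p q : K}, q ≤ p → p ∈ X → q ∈ X) :
    IsRegular (SCFOID.notS X) where
  lower := notS_lower
  dense := fun {p} h q hq hqX => by
    obtain ⟨r, hr, hr'⟩ := h q hq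
    exact hr' r le_rfl (hX hr hqX)

/-- The contrapositive of density. This is where classical logic enters: whatever is not forced is
refuted by a stronger condition. -/
theorem IsRegular.exists_refuting (hX : IsRegular X) (hp : p ∉ X) : ∃ q ≤ p, q ∈ SCFOID.notS X := by
  by_contra! h
  refine hp (hX.dense fun q hq => ?_)
  by_contra! h'
  exact h q hq h'

theorem isRegular_empty : IsRegular (∅ : Set K) where
  lower := fun _ h => h
  dense := fun {p} h => by
    obtain ⟨r, _, hr⟩ := h p le_rfl
    exact hr

theorem isRegular_univ : IsRegular (Set.univ : Set K) where
  lower := fun _ h => h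
  dense := fun _ => trivial

theorem IsRegular.inter (hX : IsRegular X) (hY : IsRegular Y) : IsRegular (X ∩ Y) where
  lower := fun h hp => ⟨hX.lower h hp.1, hY.lower h hp.2⟩
  dense := fun h =>
    ⟨hX.dense fun q hq => let ⟨r, hr, hr'⟩ := h q hq; ⟨r, hr, hr'.1⟩,
      hY.dense fun q hq => let ⟨r, hr, hr'⟩ := h q hq; ⟨r, hr, hr'.2⟩⟩

theorem isRegular_iInter {ι : Sort*} {X : ι → Set K} (hX : ∀ i, IsRegular (X i)) :
    IsRegular (⋂ i, X i) where
  lower := fun h hp => Set.mem_iInter.2 fun i => (hX i).lower h (Set.mem_iInter.1 hp i)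
  dense := fun h => Set.mem_iInter.2 fun i => (hX i).dense fun q hq =>
    let ⟨r, hr, hr'⟩ := h q hq; ⟨r, hr, Set.mem_iInter.1 hr' i⟩

theorem IsRegular.impS (hX : IsRegular X) (hY : IsRegular Y) : IsRegular (impS X Y) where
  lower := fun h hp r hr => hp r (hr.trans h)
  dense := fun {p} h q hq hqX => hY.dense fun r hr => by
    obtain ⟨r', hr', h'⟩ := h r (hr.trans hq)
    exact ⟨r', hr', h' r' le_rfl (hX.lower (hr'.trans hr) hqX)⟩

theorem isRegular_orS : IsRegular (orS X Y) :=
  isRegular_notS_of_lower fun h hp => ⟨notS_lower h hp.1, notS_lower h hp.2⟩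

theorem isRegular_exS {ι : Type*} {X : ι → Set K} : IsRegular (exS X) :=
  isRegular_notS_of_lower fun h hp =>
    Set.mem_iInter.2 fun i => notS_lower h (Set.mem_iInter.1 hp i)

theorem mem_orS_left (hX : IsRegular X) (h : p ∈ X) : p ∈ orS X Y :=
  fun q hq hq' => hq'.1 q le_rfl (hX.lower hq h)

theorem mem_orS_right (hY : IsRegular Y) (h : p ∈ Y) : p ∈ orS X Y :=
  fun q hq hq' => hq'.2 q le_rfl (hY.lower hq h)

theorem mem_exS {ι : Type*} {X : ι → Set K} (i : ι) (hX : IsRegular (X i)) (h : p ∈ X i) :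
    p ∈ exS X :=
  fun q hq hq' => Set.mem_iInter.1 hq' i q le_rfl (hX.lower hq h)

/-- `X` and `Y` contain the same conditions below `p`. -/
def EqBelow (p : K) (X Y : Set K) : Prop := ∀ q ≤ p, (q ∈ X ↔ q ∈ Y)

theorem EqBelow.notS {X Y : Set K} (h : EqBelow p X Y) : EqBelow p (notS X) (notS Y) :=
  fun _ hq => forall₂_congr fun r hr => not_congr (h r (hr.trans hq))

theorem EqBelow.inter {X Y X' Y' : Set K} (h : EqBelow p X Y) (h' : EqBelow p X' Y') :
    EqBelow p (X ∩ X') (Y ∩ Y') :=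
  fun q hq => and_congr (h q hq) (h' q hq)

theorem EqBelow.impS {X Y X' Y' : Set K} (h : EqBelow p X Y) (h' : EqBelow p X' Y') :
    EqBelow p (impS X X') (impS Y Y') :=
  fun _ hq => forall₂_congr fun r hr => imp_congr (h r (hr.trans hq)) (h' r (hr.trans hq))

theorem EqBelow.iInter {ι : Sort*} {X Y : ι → Set K} (h : ∀ i, EqBelow p (X i) (Y i)) :
    EqBelow p (⋂ i, X i) (⋂ i, Y i) := fun q hq => by
  simp only [Set.mem_iInter]
  exact forall_congr' fun i => h i q hq

theorem EqBelow.orS {X Y X' Y' : Set K} (h : EqBelow p X Y) (h' : EqBelow p X' Y') :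
    EqBelow p (orS X X') (orS Y Y') :=
  (h.notS.inter h'.notS).notS

theorem EqBelow.exS {ι : Type*} {X Y : ι → Set K} (h : ∀ i, EqBelow p (X i) (Y i)) :
    EqBelow p (exS X) (exS Y) :=
  (EqBelow.iInter fun i => (h i).notS).notS

end Regular

/-! ### Interpretations over the set of all terms -/

/-- A forcing interpretation of equality on the set of all terms. -/
structure EqInterp (L : FirstOrder.Language.{u, v}) (α : Type w) (K : Type*) [Preorder K] where
  val : Tm L α 0 → Tm L α 0 → Set K
  regular : ∀ t s, IsRegular (val t s)
  refl : ∀ p t, p ∈ val t t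
  symm : ∀ {p t s}, p ∈ val t s → p ∈ val s t
  trans : ∀ {p t s r}, p ∈ val t s → p ∈ val s r → p ∈ val t r
  congr : ∀ {p k} (f : L.Functions k) (ts ss : Fin k → Tm L α 0),
    (∀ i, p ∈ val (ts i) (ss i)) → p ∈ val (Term.func f ts) (Term.func f ss)

/-- Forcing interpretations of a `k`-ary predicate symbol. -/
structure PredVal {L : FirstOrder.Language.{u, v}} {α : Type w} {K : Type*} [Preorder K]
    (E : EqInterp L α K) (k : ℕ) where
  val : (Fin k → Tm L α 0) → Set K
  regular : ∀ ts, IsRegular (val ts)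
  ext : ∀ {p ts ss}, (∀ i, p ∈ E.val (ts i) (ss i)) → p ∈ val ts → p ∈ val ss

section Semantics

variable {L : FirstOrder.Language.{u, v}} {α : Type w} {K : Type*} [Preorder K]
  {E : EqInterp L α K}

variable (E) in
/-- An interpretation of all predicate symbols. -/
abbrev Interp := (Q : Pred L) → PredVal E Q.1

/-- `σ` and `τ` have equal values according to `p`. -/
def EqInterp.SubEq (E : EqInterp L α K) {n : ℕ} (p : K) (σ τ : Sub L α n 0) : Prop :=
  ∀ a, p ∈ E.val (σ a) (τ a)

theorem EqInterp.SubEq.lower {n : ℕ} {p q : K} {σ τ : Sub L α n 0} (h : E.SubEq p σ τ)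
    (hq : q ≤ p) : E.SubEq q σ τ :=
  fun a => (E.regular _ _).lower hq (h a)

theorem EqInterp.SubEq.symm {n : ℕ} {p : K} {σ τ : Sub L α n 0} (h : E.SubEq p σ τ) :
    E.SubEq p τ σ :=
  fun a => E.symm (h a)

theorem EqInterp.SubEq.snoc {n : ℕ} {p : K} {σ τ : Sub L α n 0} (h : E.SubEq p σ τ)
    (t : Tm L α 0) : E.SubEq p (σ.snoc t) (τ.snoc t) := by
  rintro (x | i)
  · exact h _
  · refine Fin.lastCases ?_ (fun i => ?_) i
    · simpa [Sub.snoc] using E.refl p t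
    · simpa [Sub.snoc] using h (Sum.inr i)

theorem EqInterp.SubEq.append {n k : ℕ} {p : K} {σ τ : Sub L α n 0} (h : E.SubEq p σ τ)
    (s : Fin k → Tm L α 0) : E.SubEq p (σ.append s) (τ.append s) := by
  rintro (x | i)
  · exact h _
  · refine Fin.addCases (fun i => ?_) (fun i => ?_) i
    · simpa [Sub.append] using h (Sum.inr i)
    · simpa [Sub.append] using E.refl p (s i)

theorem EqInterp.SubEq.term {n : ℕ} {p : K} {σ τ : Sub L α n 0} (h : E.SubEq p σ τ)
    (t : Tm L α n) : p ∈ E.val (t.subst σ) (t.subst τ) := by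
  induction t with
  | var a => exact h a
  | func f ts ih => exact E.congr f _ _ ih

theorem PredVal.eqBelow {k : ℕ} (Y : PredVal E k) {p : K} {ts ss : Fin k → Tm L α 0}
    (h : ∀ i, p ∈ E.val (ts i) (ss i)) : EqBelow p (Y.val ts) (Y.val ss) := fun _ hq =>
  ⟨Y.ext fun i => (E.regular _ _).lower hq (h i),
    Y.ext fun i => E.symm ((E.regular _ _).lower hq (h i))⟩

/-- The pair of interpretations that uses `A` at positive and `B` at negative occurrences. -/
def dual (A B : Interp E) : Bool → Interp E
  | true => A
  | false => B

open Classical in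
/-- The interpretation that agrees with `Y` on `Ps` and with `I` elsewhere. -/
noncomputable def Interp.override (I : Interp E) (Ps : Set (Pred L)) (Y : Interp E) : Interp E :=
  fun Q => if Q ∈ Ps then Y Q else I Q

theorem Interp.override_pos (I : Interp E) {Ps : Set (Pred L)} (Y : Interp E) {Q : Pred L}
    (h : Q ∈ Ps) : I.override Ps Y Q = Y Q := if_pos h

theorem Interp.override_neg (I : Interp E) {Ps : Set (Pred L)} (Y : Interp E) {Q : Pred L}
    (h : Q ∉ Ps) : I.override Ps Y Q = I Q := if_neg h

/-- The conditions that force `φ` under the assignment `σ`, where occurrences of the polarity `b` are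
interpreted by `I b`. -/
def FO.force (I : Bool → Interp E) : {n : ℕ} → Bool → FO L α n → Sub L α n 0 → Set K
  | _, _, verum, _ => Set.univ
  | _, _, falsum, _ => ∅
  | _, _, equal t s, σ => E.val (t.subst σ) (s.subst σ)
  | _, b, @rel _ _ _ k P ts, σ => (I b ⟨k, P⟩).val (fun i => (ts i).subst σ)
  | _, b, neg φ, σ => notS (φ.force I (!b) σ)
  | _, b, and φ ψ, σ => φ.force I b σ ∩ ψ.force I b σ
  | _, b, or φ ψ, σ => orS (φ.force I b σ) (ψ.force I b σ)
  | _, b, imp φ ψ, σ => impS (φ.force I (!b) σ) (ψ.force I b σ)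
  | _, b, iff φ ψ, σ =>
      impS (φ.force I (!b) σ) (ψ.force I b σ) ∩ impS (ψ.force I (!b) σ) (φ.force I b σ)
  | _, b, all φ, σ => ⋂ t, φ.force I b (σ.snoc t)
  | _, b, ex φ, σ => exS fun t => φ.force I b (σ.snoc t)

theorem FO.force_regular (I : Bool → Interp E) {n : ℕ} (b : Bool) (φ : FO L α n)
    (σ : Sub L α n 0) : IsRegular (φ.force I b σ) := by
  induction φ generalizing b with
  | verum => exact isRegular_univ
  | falsum => exact isRegular_empty
  | equal t s => exact E.regular _ _
  | rel P ts => exact (I b _).regular _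
  | neg φ ih => exact (ih _ _).notS
  | and φ ψ ih ih' => exact (ih _ _).inter (ih' _ _)
  | or φ ψ ih ih' => exact isRegular_orS
  | imp φ ψ ih ih' => exact (ih _ _).impS (ih' _ _)
  | iff φ ψ ih ih' => exact ((ih _ _).impS (ih' _ _)).inter ((ih' _ _).impS (ih _ _))
  | all φ ih => exact isRegular_iInter fun t => ih _ _
  | ex φ ih => exact isRegular_exS

theorem FO.force_eqBelow (I : Bool → Interp E) {n : ℕ} (b : Bool) (φ : FO L α n) {p : K}
    {σ τ : Sub L α n 0} (h : E.SubEq p σ τ) : EqBelow p (φ.force I b σ) (φ.force I b τ) := by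
  induction φ generalizing b with
  | verum => exact fun _ _ => Iff.rfl
  | falsum => exact fun _ _ => Iff.rfl
  | equal t s =>
    intro q hq
    have h' := h.lower hq
    exact ⟨fun hh => E.trans (h'.symm.term t) (E.trans hh (h'.term s)),
      fun hh => E.trans (h'.term t) (E.trans hh (h'.symm.term s))⟩
  | rel P ts => exact (I b _).eqBelow fun i => h.term (ts i)
  | neg φ ih => exact (ih _ h).notS
  | and φ ψ ih ih' => exact (ih _ h).inter (ih' _ h)
  | or φ ψ ih ih' => exact (ih _ h).orS (ih' _ h)
  | imp φ ψ ih ih' => exact (ih _ h).impS (ih' _ h)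
  | iff φ ψ ih ih' => exact ((ih _ h).impS (ih' _ h)).inter ((ih' _ h).impS (ih _ h))
  | all φ ih => exact EqBelow.iInter fun t => ih _ (h.snoc t)
  | ex φ ih => exact EqBelow.exS fun t => ih _ (h.snoc t)

theorem FO.force_subst (I : Bool → Interp E) {n m : ℕ} (b : Bool) (φ : FO L α n)
    (σ : Sub L α n m) (τ : Sub L α m 0) :
    (φ.subst σ).force I b τ = φ.force I b (σ.comp τ) := by
  induction φ generalizing b m with
  | verum => rfl
  | falsum => rfl
  | equal t s => simp [FO.subst, FO.force, Tm.subst_subst]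
  | rel P ts => simp [FO.subst, FO.force, Tm.subst_subst]
  | neg φ ih => simp [FO.subst, FO.force, ih]
  | and φ ψ ih ih' => simp [FO.subst, FO.force, ih, ih']
  | or φ ψ ih ih' => simp [FO.subst, FO.force, ih, ih']
  | imp φ ψ ih ih' => simp [FO.subst, FO.force, ih, ih']
  | iff φ ψ ih ih' => simp [FO.subst, FO.force, ih, ih']
  | all φ ih => simp [FO.subst, FO.force, ih, Sub.lift_comp_snoc]
  | ex φ ih => simp [FO.subst, FO.force, ih, Sub.lift_comp_snoc]

/-- The predicate interpretation defined by a formula with place holders and an assignment of its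
object symbols. -/
def FO.predVal (I : Interp E) {k : ℕ} (φ : FO L α k) (ρ : α → Tm L α 0) : PredVal E k where
  val ts := φ.force (fun _ => I) true (Sum.elim ρ ts)
  regular ts := φ.force_regular _ _ _
  ext {p ts ss} h hp := by
    refine (φ.force_eqBelow _ _ (p := p) (fun a => ?_) p le_rfl).1 hp
    rcases a with x | i
    · exact E.refl _ _
    · exact h i

/-- Syntactic replacement at positive occurrences amounts to changing the positive half of a pair of
interpretations. The forcing clause for `iff` consists of two implications with the same polarities
as the unwinding in `repl`, so the two agree there as well. -/
theorem FO.force_repl (I : Interp E) (Ps : Set (Pred L)) (F : (Q : Pred L) → FO L α Q.1)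
    (ρ : α → Tm L α 0) {n : ℕ} (b : Bool) (φ : FO L α n) (σ : Sub L α n 0)
    (hσ : ∀ x, σ (Sum.inl x) = ρ x) :
    (φ.repl Ps F b).force (fun _ => I) b σ =
      φ.force (dual (I.override Ps fun Q => (F Q).predVal I ρ) I) b σ := by
  induction φ generalizing b with
  | verum => rfl
  | falsum => rfl
  | equal t s => rfl
  | @rel n k P ts =>
    cases b
    · rfl
    · by_cases h : (⟨k, P⟩ : Pred L) ∈ Ps
      · simp only [FO.repl, if_pos h, FO.force, dual, Interp.override_pos _ _ h, FO.predVal,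
          FO.app, FO.force_subst]
        congr 1
        funext a
        rcases a with x | i
        · exact hσ x
        · rfl
      · simp only [FO.repl, if_neg h, FO.force, dual, Interp.override_neg _ _ h]
  | neg φ ih => simp only [FO.repl, FO.force]; rw [ih _ _ hσ]
  | and φ ψ ih ih' => simp only [FO.repl, FO.force]; rw [ih _ _ hσ, ih' _ _ hσ]
  | or φ ψ ih ih' => simp only [FO.repl, FO.force]; rw [ih _ _ hσ, ih' _ _ hσ]
  | imp φ ψ ih ih' => simp only [FO.repl, FO.force]; rw [ih _ _ hσ, ih' _ _ hσ]
  | iff φ ψ ih ih' =>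
    simp only [FO.repl, FO.force]; rw [ih _ _ hσ, ih' _ _ hσ, ih _ _ hσ, ih' _ _ hσ]
  | all φ ih =>
    simp only [FO.repl, FO.force]
    congr 1; funext t
    exact ih _ _ hσ
  | ex φ ih =>
    simp only [FO.repl, FO.force]
    congr 1; funext t
    exact ih _ _ hσ

/-! ### Forcing of definitions -/

/-- The conditions that force the rules of `Φ` with heads in `Ps`, where heads and positive occurrences
in bodies are interpreted by `A`, and negative occurrences in bodies by `B`. -/
def Defn.Closed {n : ℕ} (Φ : Defn L α n) (σ : Sub L α n 0) (A B : Interp E) (Ps : Set (Pred L)) :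
    Set K :=
  {p | ∀ r ∈ Φ, r.headPred ∈ Ps → ∀ s : Fin r.bound → Tm L α 0,
    p ∈ impS (r.body.force (dual A B) true (σ.append s))
      ((A r.headPred).val fun i : Fin r.arity => (r.args i).subst (σ.append s))}

theorem Defn.closed_regular {n : ℕ} (Φ : Defn L α n) (σ : Sub L α n 0) (A B : Interp E)
    (Ps : Set (Pred L)) : IsRegular (Defn.Closed Φ σ A B Ps) := by
  have h : ∀ (r : DefRule L α n) (s : Fin r.bound → Tm L α 0), IsRegular (impS (r.body.force (dual A B) true (σ.append s))
      ((A r.headPred).val fun i : Fin r.arity => (r.args i).subst (σ.append s))) := fun r s =>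
    (FO.force_regular _ _ _ _).impS ((A r.headPred).regular _)
  exact ⟨fun hq hp r hr hr' s => (h r s).lower hq (hp r hr hr' s),
    fun hp r hr hr' s => (h r s).dense fun q hq =>
      let ⟨q', hq', hh⟩ := hp q hq
      ⟨q', hq', hh r hr hr' s⟩⟩

theorem Defn.closed_eqBelow {n : ℕ} (Φ : Defn L α n) {p : K} {σ τ : Sub L α n 0}
    (h : E.SubEq p σ τ) (A B : Interp E) (Ps : Set (Pred L)) :
    EqBelow p (Defn.Closed Φ σ A B Ps) (Defn.Closed Φ τ A B Ps) := by
  intro q hq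
  refine forall₄_congr fun r _ _ s => ?_
  exact ((FO.force_eqBelow _ _ _ (h.append s)).impS
    ((A r.headPred).eqBelow fun i => (h.append s).term _)) q hq

theorem Defn.closed_subst {n m : ℕ} (Φ : Defn L α n) (σ : Sub L α n m) (τ : Sub L α m 0)
    (A B : Interp E) (Ps : Set (Pred L)) :
    Defn.Closed (Defn.subst Φ σ) τ A B Ps = Defn.Closed Φ (σ.comp τ) A B Ps := by
  have key : ∀ (r : DefRule L α n) (s : Fin r.bound → Tm L α 0),
      impS ((r.subst σ).body.force (dual A B) true (τ.append s))
        ((A (r.subst σ).headPred).val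
          fun i : Fin r.arity => ((r.subst σ).args i).subst (τ.append s)) =
      impS (r.body.force (dual A B) true ((σ.comp τ).append s))
        ((A r.headPred).val fun i : Fin r.arity => (r.args i).subst ((σ.comp τ).append s)) := by
    intro r s
    simp only [DefRule.subst, FO.force_subst, Tm.subst_subst, Sub.liftN_comp_append]
    rfl
  ext p
  constructor
  · intro h r hr hr' s
    have := h (r.subst σ) ((Defn.mem_subst _ _ _).2 ⟨r, hr, rfl⟩) hr' s
    exact (key r s) ▸ this
  · intro h r' hr₀ hr' s
    obtain ⟨r, hr, rfl⟩ := (Defn.mem_subst _ _ _).1 hr₀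
    have := h r hr hr' s
    exact (key r s).symm ▸ this

/-- The conditions that force the induction principle of `Φ` for the predicates in `Ps` and the
interpretation `Y` of the induction hypotheses. -/
def Defn.Induction {n : ℕ} (Φ : Defn L α n) (σ : Sub L α n 0) (I : Interp E) (Ps : Set (Pred L))
    (Y : Interp E) : Set K :=
  impS (Defn.Closed Φ σ (I.override Ps Y) I Ps)
    (⋂ Q : Ps, ⋂ ts, impS ((I Q).val ts) ((Y Q).val ts))

/-- The conditions that force a definition: its rules, and induction for all families of predicates
that are definable by first-order formulas with parameters. -/
def Defn.force {n : ℕ} (I : Interp E) (Φ : Defn L α n) (σ : Sub L α n 0) : Set K :=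
  Defn.Closed Φ σ I I Set.univ ∩
    -- All values `ρ` of the parameters are allowed, not only those given by `σ`. The induction part
    -- then depends on `σ` only through the rules, which makes it stable under substitution.
    ⋂ (Ps : Set (Pred L)) (_ : Ps ⊆ Defn.defined Φ) (F : (Q : Pred L) → FO L α Q.1)
      (ρ : α → Tm L α 0),
      Defn.Induction Φ σ I Ps fun Q => (F Q).predVal I ρ

theorem Defn.force_regular {n : ℕ} (I : Interp E) (Φ : Defn L α n) (σ : Sub L α n 0) :
    IsRegular (Defn.force I Φ σ) :=
  (Defn.closed_regular _ _ _ _ _).inter <| isRegular_iInter fun _ => isRegular_iInter fun _ =>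
    isRegular_iInter fun F =>
    isRegular_iInter fun ρ => (Defn.closed_regular _ _ _ _ _).impS <| isRegular_iInter fun Q =>
      isRegular_iInter fun ts => ((I Q).regular ts).impS (((F Q).predVal I ρ).regular ts)

theorem Defn.force_eqBelow {n : ℕ} (I : Interp E) (Φ : Defn L α n) {p : K} {σ τ : Sub L α n 0}
    (h : E.SubEq p σ τ) : EqBelow p (Defn.force I Φ σ) (Defn.force I Φ τ) :=
  (Defn.closed_eqBelow Φ h _ _ _).inter <| EqBelow.iInter fun _ => EqBelow.iInter fun _ =>
    EqBelow.iInter fun _ => EqBelow.iInter fun _ => (Defn.closed_eqBelow Φ h _ _ _).impS fun _ _ => Iff.rfl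

theorem Defn.force_subst {n m : ℕ} (I : Interp E) (Φ : Defn L α n) (σ : Sub L α n m)
    (τ : Sub L α m 0) :
    Defn.force I (Defn.subst Φ σ) τ = Defn.force I Φ (σ.comp τ) := by
  unfold Defn.force Defn.Induction
  simp only [Defn.closed_subst, Defn.defined_subst]

/-! ### Forcing of FO(ID)-formulas -/

/-- The conditions that force an FO(ID)-formula. -/
def FOID.force (I : Interp E) : {n : ℕ} → FOID L α n → Sub L α n 0 → Set K
  | _, verum, _ => Set.univ
  | _, falsum, _ => ∅
  | _, equal t s, σ => E.val (t.subst σ) (s.subst σ)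
  | _, @rel _ _ _ k P ts, σ => (I ⟨k, P⟩).val (fun i => (ts i).subst σ)
  | _, defn Φ, σ => Defn.force I Φ σ
  | _, neg φ, σ => notS (φ.force I σ)
  | _, and φ ψ, σ => φ.force I σ ∩ ψ.force I σ
  | _, or φ ψ, σ => orS (φ.force I σ) (ψ.force I σ)
  | _, imp φ ψ, σ => impS (φ.force I σ) (ψ.force I σ)
  | _, iff φ ψ, σ => impS (φ.force I σ) (ψ.force I σ) ∩ impS (ψ.force I σ) (φ.force I σ)
  | _, all φ, σ => ⋂ t, φ.force I (σ.snoc t)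
  | _, ex φ, σ => exS fun t => φ.force I (σ.snoc t)

theorem FOID.force_regular (I : Interp E) {n : ℕ} (φ : FOID L α n) (σ : Sub L α n 0) :
    IsRegular (φ.force I σ) := by
  induction φ with
  | verum => exact isRegular_univ
  | falsum => exact isRegular_empty
  | equal t s => exact E.regular _ _
  | rel P ts => exact (I _).regular _
  | defn Φ => exact Defn.force_regular _ _ _
  | neg φ ih => exact (ih _).notS
  | and φ ψ ih ih' => exact (ih _).inter (ih' _)
  | or φ ψ ih ih' => exact isRegular_orS
  | imp φ ψ ih ih' => exact (ih _).impS (ih' _)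
  | iff φ ψ ih ih' => exact ((ih _).impS (ih' _)).inter ((ih' _).impS (ih _))
  | all φ ih => exact isRegular_iInter fun t => ih _
  | ex φ ih => exact isRegular_exS

theorem FOID.force_eqBelow (I : Interp E) {n : ℕ} (φ : FOID L α n) {p : K}
    {σ τ : Sub L α n 0} (h : E.SubEq p σ τ) : EqBelow p (φ.force I σ) (φ.force I τ) := by
  induction φ with
  | verum => exact fun _ _ => Iff.rfl
  | falsum => exact fun _ _ => Iff.rfl
  | equal t s =>
    intro q hq
    have h' := h.lower hq
    exact ⟨fun hh => E.trans (h'.symm.term t) (E.trans hh (h'.term s)),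
      fun hh => E.trans (h'.term t) (E.trans hh (h'.symm.term s))⟩
  | rel P ts => exact (I _).eqBelow fun i => h.term (ts i)
  | defn Φ => exact Defn.force_eqBelow I Φ h
  | neg φ ih => exact (ih h).notS
  | and φ ψ ih ih' => exact (ih h).inter (ih' h)
  | or φ ψ ih ih' => exact (ih h).orS (ih' h)
  | imp φ ψ ih ih' => exact (ih h).impS (ih' h)
  | iff φ ψ ih ih' => exact ((ih h).impS (ih' h)).inter ((ih' h).impS (ih h))
  | all φ ih => exact EqBelow.iInter fun t => ih (h.snoc t)
  | ex φ ih => exact EqBelow.exS fun t => ih (h.snoc t)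

theorem FOID.force_subst (I : Interp E) {n m : ℕ} (φ : FOID L α n)
    (σ : Sub L α n m) (τ : Sub L α m 0) :
    (φ.subst σ).force I τ = φ.force I (σ.comp τ) := by
  induction φ generalizing m with
  | verum => rfl
  | falsum => rfl
  | equal t s => simp [FOID.subst, FOID.force, Tm.subst_subst]
  | rel P ts => simp [FOID.subst, FOID.force, Tm.subst_subst]
  | defn Φ => exact Defn.force_subst I Φ σ τ
  | neg φ ih => simp [FOID.subst, FOID.force, ih]
  | and φ ψ ih ih' => simp [FOID.subst, FOID.force, ih, ih']
  | or φ ψ ih ih' => simp [FOID.subst, FOID.force, ih, ih']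
  | imp φ ψ ih ih' => simp [FOID.subst, FOID.force, ih, ih']
  | iff φ ψ ih ih' => simp [FOID.subst, FOID.force, ih, ih']
  | all φ ih => simp [FOID.subst, FOID.force, ih, Sub.lift_comp_snoc]
  | ex φ ih => simp [FOID.subst, FOID.force, ih, Sub.lift_comp_snoc]

/-- A constant pair of interpretations does not see polarities, so `b` may be chosen freely. -/
theorem FOID.force_toFOID (I : Interp E) {n : ℕ} (b : Bool) (φ : FO L α n) (σ : Sub L α n 0) :
    φ.toFOID.force I σ = φ.force (fun _ => I) b σ := by
  induction φ generalizing b with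
  | verum => rfl
  | falsum => rfl
  | equal t s => rfl
  | rel P ts => rfl
  | neg φ ih => simp only [FO.toFOID, FOID.force, FO.force]; rw [ih]
  | and φ ψ ih ih' => simp only [FO.toFOID, FOID.force, FO.force]; rw [ih, ih']
  | or φ ψ ih ih' => simp only [FO.toFOID, FOID.force, FO.force]; rw [ih, ih']
  | imp φ ψ ih ih' => simp only [FO.toFOID, FOID.force, FO.force]; rw [ih, ih']
  | iff φ ψ ih ih' =>
    simp only [FO.toFOID, FOID.force, FO.force]
    rw [← ih (!b), ← ih' b, ← ih' (!b), ← ih b]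
  | all φ ih =>
    simp only [FO.toFOID, FOID.force, FO.force]
    congr 1; funext t
    exact ih _ _
  | ex φ ih =>
    simp only [FO.toFOID, FOID.force, FO.force]
    congr 1; funext t
    exact ih _ _

/-- Forcing depends only on the values of the object symbols that occur freely. -/
theorem FOID.force_congr (I : Interp E) {n : ℕ} (φ : FOID L α n) {σ τ : Sub L α n 0}
    (h : ∀ x ∈ φ.objs, σ (Sum.inl x) = τ (Sum.inl x))
    (h' : ∀ i, σ (Sum.inr i) = τ (Sum.inr i)) : φ.force I σ = φ.force I τ := by
  -- An assignment is a substitution by terms followed by the identity assignment, so the claim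
  -- reduces to the syntactic `FOID.subst_congr`.
  have h1 := FOID.force_subst I φ σ (Sub.ident L α 0)
  have h2 := FOID.force_subst I φ τ (Sub.ident L α 0)
  rw [Sub.comp_id] at h1 h2
  rw [← h1, ← h2, FOID.subst_congr φ σ τ h h']

theorem FO.force_congr (I : Bool → Interp E) {n : ℕ} (b : Bool) (φ : FO L α n)
    {σ τ : Sub L α n 0} (h : ∀ x ∈ φ.objs, σ (Sum.inl x) = τ (Sum.inl x))
    (h' : ∀ i, σ (Sum.inr i) = τ (Sum.inr i)) : φ.force I b σ = φ.force I b τ := by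
  have h1 := FO.force_subst I b φ σ (Sub.ident L α 0)
  have h2 := FO.force_subst I b φ τ (Sub.ident L α 0)
  rw [Sub.comp_id] at h1 h2
  rw [← h1, ← h2, FO.subst_congr φ σ τ h h']

end Semantics

/-! ### Soundness -/

section Soundness

variable {L : FirstOrder.Language.{u, v}} {α : Type w} {K : Type*} [Preorder K]
  {E : EqInterp L α K}

theorem elim_obj_comp {k n : ℕ} (s : Fin k → Tm L α n) (ρ : Sub L α n 0) :
    Sub.comp (Sum.elim Tm.obj s : Sub L α k n) ρ =
      (Sum.elim (fun x => ρ (Sum.inl x)) fun i => (s i).subst ρ : Sub L α k 0) := by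
  funext a
  rcases a with x | i <;> rfl

theorem elim_fin_one (ρ : Sub L α 0 0) (t : Tm L α 0) :
    (Sum.elim (fun x => ρ (Sum.inl x)) fun _ => t : Sub L α 1 0) = ρ.snoc t := by
  funext a
  rcases a with x | i
  · rfl
  · refine Fin.lastCases ?_ (fun i => i.elim0) i
    simp only [Sub.snoc, Sum.elim_inr, Fin.lastCases_last]

theorem DefRule.instSub_comp {k : ℕ} (s : Fin k → Tm L α 0) (ρ : Sub L α 0 0) :
    (DefRule.instSub s).comp ρ = ρ.append fun i => (s i).subst ρ := by
  funext a
  rcases a with x | i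
  · rfl
  · refine Fin.addCases (fun i => i.elim0) (fun i => ?_) i
    simp only [Sub.comp, DefRule.instSub, Sub.append, Sum.elim_inr, Fin.addCases_right]
    congr 2
    ext
    simp

theorem DefRule.force_instBody (I : Bool → Interp E) (b : Bool) (r : DefRule L α 0)
    (s : Fin r.bound → Tm L α 0) (ρ : Sub L α 0 0) :
    (r.instBody s).force I b ρ = r.body.force I b (ρ.append fun i => (s i).subst ρ) := by
  rw [DefRule.instBody, FO.force_subst, DefRule.instSub_comp]

theorem DefRule.instArgs_subst (r : DefRule L α 0) (s : Fin r.bound → Tm L α 0)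
    (ρ : Sub L α 0 0) (i : Fin r.arity) :
    (r.instArgs s i).subst ρ = (r.args i).subst (ρ.append fun i => (s i).subst ρ) := by
  rw [DefRule.instArgs, Tm.subst_subst, DefRule.instSub_comp]

theorem dual_self (I : Interp E) : dual I I = fun _ => I := by
  funext b
  cases b <;> rfl

theorem PredVal.eq_of_val_eq {k : ℕ} {Y Z : PredVal E k} (h : Y.val = Z.val) : Y = Z := by
  cases Y
  cases Z
  cases h
  rfl

theorem FO.predVal_congr (I : Interp E) {k : ℕ} (φ : FO L α k) {ρ ρ' : α → Tm L α 0}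
    (h : ∀ x ∈ φ.objs, ρ x = ρ' x) : φ.predVal I ρ = φ.predVal I ρ' :=
  PredVal.eq_of_val_eq <| funext fun _ => FO.force_congr _ _ _ h fun _ => rfl

theorem Interp.override_congr (I : Interp E) {Ps : Set (Pred L)} {Y Z : Interp E}
    (h : ∀ Q ∈ Ps, Y Q = Z Q) : I.override Ps Y = I.override Ps Z := by
  funext Q
  by_cases hQ : Q ∈ Ps
  · rw [Interp.override_pos _ _ hQ, Interp.override_pos _ _ hQ, h Q hQ]
  · rw [Interp.override_neg _ _ hQ, Interp.override_neg _ _ hQ]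

theorem FOID.force_inst (I : Interp E) (φ : FOID L α 1) (t : Tm L α 0) (ρ : Sub L α 0 0) :
    (φ.inst t).force I ρ = φ.force I (ρ.snoc (t.subst ρ)) := by
  rw [FOID.inst, FOID.force_subst, elim_obj_comp, elim_fin_one]

theorem FOID.force_app (I : Interp E) {k : ℕ} (φ : FO L α k) (s : Fin k → Tm L α 0)
    (ρ : Sub L α 0 0) :
    (φ.app s).toFOID.force I ρ =
      (φ.predVal I fun x => ρ (Sum.inl x)).val fun i => (s i).subst ρ := by
  rw [FOID.force_toFOID I true, FO.app, FO.force_subst, elim_obj_comp]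
  rfl

/-- `p` forces all members of `Γ`. -/
def Forces (I : Interp E) (ρ : Sub L α 0 0) (p : K) (Γ : Set (FOID L α 0)) : Prop :=
  ∀ φ ∈ Γ, p ∈ φ.force I ρ

/-- `p` forces the negations of all members of `Δ`. -/
def Refutes (I : Interp E) (ρ : Sub L α 0 0) (p : K) (Δ : Set (FOID L α 0)) : Prop :=
  ∀ φ ∈ Δ, p ∈ notS (φ.force I ρ)

/-- The sequent `Γ ⊢ Δ` holds: no condition forces all of `Γ` and refutes all of `Δ`. -/
def Holds (I : Interp E) (Γ Δ : Set (FOID L α 0)) : Prop :=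
  ∀ (ρ : Sub L α 0 0) (p : K), Forces I ρ p Γ → Refutes I ρ p Δ → False

variable {I : Interp E} {ρ : Sub L α 0 0} {p q : K} {Γ Δ : Set (FOID L α 0)} {φ : FOID L α 0}

theorem Forces.lower (h : Forces I ρ p Γ) (hq : q ≤ p) : Forces I ρ q Γ :=
  fun φ hφ => (φ.force_regular I ρ).lower hq (h φ hφ)

theorem Refutes.lower (h : Refutes I ρ p Δ) (hq : q ≤ p) : Refutes I ρ q Δ :=
  fun φ hφ => notS_lower hq (h φ hφ)

theorem forces_insert : Forces I ρ p (insert φ Γ) ↔ p ∈ φ.force I ρ ∧ Forces I ρ p Γ :=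
  Set.forall_mem_insert

theorem refutes_insert : Refutes I ρ p (insert φ Δ) ↔ p ∈ notS (φ.force I ρ) ∧ Refutes I ρ p Δ :=
  Set.forall_mem_insert

theorem Forces.congr {ρ' : Sub L α 0 0} (h : Forces I ρ p Γ)
    (hρ : ∀ x ∈ FOID.free Γ, ρ (Sum.inl x) = ρ' (Sum.inl x)) : Forces I ρ' p Γ := fun φ hφ =>
  φ.force_congr I (fun x hx => hρ x (Set.mem_biUnion hφ hx)) (fun i => i.elim0) ▸ h φ hφ

theorem Refutes.congr {ρ' : Sub L α 0 0} (h : Refutes I ρ p Δ)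
    (hρ : ∀ x ∈ FOID.free Δ, ρ (Sum.inl x) = ρ' (Sum.inl x)) : Refutes I ρ' p Δ := fun φ hφ =>
  φ.force_congr I (fun x hx => hρ x (Set.mem_biUnion hφ hx)) (fun i => i.elim0) ▸ h φ hφ

/-- If `p` did not force `φ`, regularity would give a stronger condition refuting it, against the
sequent. Soundness of cut and of most rules acting on the right rests on this. -/
theorem Holds.mem_force (h : Holds I Γ (insert φ Δ)) (hΓ : Forces I ρ p Γ)
    (hΔ : Refutes I ρ p Δ) : p ∈ φ.force I ρ := by
  by_contra hp
  obtain ⟨q, hq, hq'⟩ := (φ.force_regular I ρ).exists_refuting hp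
  exact h ρ q (hΓ.lower hq) (refutes_insert.2 ⟨hq', hΔ.lower hq⟩)

theorem Holds.mem_notS (h : Holds I (insert φ Γ) Δ) (hΓ : Forces I ρ p Γ)
    (hΔ : Refutes I ρ p Δ) : p ∈ notS (φ.force I ρ) :=
  fun q hq hq' => h ρ q (forces_insert.2 ⟨hq', hΓ.lower hq⟩) (hΔ.lower hq)

/-- The assignment that maps `x` to `t` and agrees with `ρ` elsewhere. -/
noncomputable def Sub.set (ρ : Sub L α 0 0) (x : α) (t : Tm L α 0) : Sub L α 0 0 :=
  open Classical in Function.update ρ (Sum.inl x) t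

theorem Sub.set_self (ρ : Sub L α 0 0) (x : α) (t : Tm L α 0) : ρ.set x t (Sum.inl x) = t := by
  simp [Sub.set]

theorem Sub.set_of_ne (ρ : Sub L α 0 0) {x z : α} (t : Tm L α 0) (h : z ≠ x) :
    ρ.set x t (Sum.inl z) = ρ (Sum.inl z) := by
  simp [Sub.set, h]

theorem Sub.set_of_notMem (ρ : Sub L α 0 0) {x : α} (t : Tm L α 0) {S : Set α} (h : x ∉ S) :
    ∀ z ∈ S, ρ (Sum.inl z) = ρ.set x t (Sum.inl z) :=
  fun _ hz => (ρ.set_of_ne t (ne_of_mem_of_not_mem hz h)).symm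

theorem FOID.force_inst_obj (I : Interp E) (φ : FOID L α 1) {x : α} (hx : x ∉ φ.objs)
    (t : Tm L α 0) (ρ : Sub L α 0 0) :
    (φ.inst (Tm.obj x)).force I (ρ.set x t) = φ.force I (ρ.snoc t) := by
  rw [FOID.force_inst, subst_obj, Sub.set_self]
  refine (φ.force_congr I (ρ.set_of_notMem t hx) fun i => ?_).symm
  refine Fin.lastCases ?_ (fun i => i.elim0) i
  simp only [Sub.snoc, Sum.elim_inr, Fin.lastCases_last]

theorem Holds.defR (Φ : Defn L α 0) (r : DefRule L α 0) (s : Fin r.bound → Tm L α 0)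
    (hr : r ∈ Φ) (h : Holds I (insert (.defn Φ) Γ) (insert (r.instBody s).toFOID Δ)) :
    Holds I (insert (.defn Φ) Γ) (insert (.rel r.head (r.instArgs s)) Δ) := by
  intro ρ p hΓ hΔ
  obtain ⟨h1, hΔ⟩ := refutes_insert.1 hΔ
  have h2 := h.mem_force hΓ hΔ
  have h3 := (forces_insert.1 hΓ).1.1 r hr trivial (fun i => (s i).subst ρ) p le_rfl
  rw [FOID.force_toFOID I true, DefRule.force_instBody] at h2
  rw [dual_self] at h3
  refine h1 p le_rfl ?_
  simp only [FOID.force, DefRule.instArgs_subst]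
  exact h3 h2

/-- The induction principle contained in the forcing of `Φ` is applied to the predicates defined by
`F`, with the current assignment as parameters. The premises for the rules say that these predicates
are closed. -/
theorem Holds.defL (Φ : Defn L α 0) (Ps : Set (Pred L)) (F : (Q : Pred L) → FO L α Q.1)
    (ys : (r : DefRule L α 0) → Fin r.bound → α) (P : Pred L) (ts : Fin P.1 → Tm L α 0)
    (hPs : Ps ⊆ Defn.defined Φ) (hP : P ∈ Ps) (hinj : ∀ r ∈ Φ, Function.Injective (ys r))
    (hfresh : ∀ r ∈ Φ, ∀ i, ys r i ∉ FOID.free Γ ∧ ys r i ∉ FOID.free Δ ∧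
      ys r i ∉ Defn.objs Φ ∧ ∀ Q ∈ Ps, ys r i ∉ (F Q).objs)
    (hstep : ∀ r ∈ Φ, r.headPred ∈ Ps → Holds I
      (insert ((r.instBody (fun i => Tm.obj (ys r i))).repl Ps F true).toFOID
        (insert (.defn Φ) Γ))
      (insert ((F r.headPred).app (r.instArgs (fun i => Tm.obj (ys r i)))).toFOID Δ))
    (hlast : Holds I (insert ((F P).app ts).toFOID (insert (.defn Φ) Γ)) Δ) :
    Holds I (insert (.rel P.2 ts) (insert (.defn Φ) Γ)) Δ := by
  intro ρ p hΓ hΔ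
  obtain ⟨h1, hΓ⟩ := forces_insert.1 hΓ
  obtain ⟨hΦ, hΓ'⟩ := forces_insert.1 hΓ
  have h2 := hlast.mem_notS hΓ hΔ
  rw [FOID.force_app] at h2
  have h3 := hΦ.2
  simp only [Set.mem_iInter] at h3
  have h4 := h3 Ps hPs F (fun x => ρ (Sum.inl x)) p le_rfl
  refine h2 p le_rfl (Set.mem_iInter.1 (Set.mem_iInter.1 (h4 ?_) ⟨P, hP⟩) _ p le_rfl h1)
  intro r hr hr' s q hq hbody
  -- The bound symbols receive the arbitrary values `s`. Since they are fresh, this changes the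
  -- value of no side formula, nor of `Φ` or the induction hypotheses.
  let ρ' : Sub L α 0 0 :=
    Sum.elim (Function.extend (ys r) s fun x => ρ (Sum.inl x)) fun i => i.elim0
  have hval : ∀ x, ρ' (Sum.inl x) = Function.extend (ys r) s (fun x => ρ (Sum.inl x)) x :=
    fun _ => rfl
  have hρs : (fun i => (Tm.obj (ys r i) : Tm L α 0).subst ρ') = s := by
    funext i
    rw [subst_obj, hval]
    exact (hinj r hr).extend_apply _ _ i
  have hρ : ∀ {S : Set α}, (∀ i, ys r i ∉ S) → ∀ x ∈ S, ρ (Sum.inl x) = ρ' (Sum.inl x) := by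
    intro S hS x hx
    rw [hval, Function.extend_apply']
    rintro ⟨i, rfl⟩
    exact hS i hx
  have hΦρ := hρ fun i => (hfresh r hr i).2.2.1
  have happ : ∀ i, ρ.append s (Sum.inr i) = ρ'.append s (Sum.inr i) := by
    intro i
    refine Fin.addCases (fun i => i.elim0) (fun i => ?_) i
    simp only [Sub.append, Sum.elim_inr, Fin.addCases_right]
  have hrsub : r.objs ⊆ Defn.objs Φ := Set.subset_biUnion_of_mem (u := DefRule.objs) hr
  have hΓρ : Forces I ρ' q (insert (.defn Φ) Γ) := by
    refine forces_insert.2 ⟨?_, (hΓ'.lower hq).congr (hρ fun i => (hfresh r hr i).1)⟩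
    rw [← FOID.force_congr I (.defn Φ) (σ := ρ) hΦρ fun i => i.elim0]
    exact (FOID.force_regular I _ _).lower hq hΦ
  have hΔρ := (hΔ.lower hq).congr (hρ fun i => (hfresh r hr i).2.1)
  have hF : ∀ Q ∈ Ps, (F Q).predVal I (fun x => ρ (Sum.inl x)) =
      (F Q).predVal I fun x => ρ' (Sum.inl x) := fun Q hQ =>
    FO.predVal_congr I _ (hρ fun i => (hfresh r hr i).2.2.2 Q hQ)
  rw [Interp.override_congr I hF,
    FO.force_congr _ _ r.body (τ := ρ'.append s) (fun x hx => hΦρ x (hrsub (Or.inr hx))) happ]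
    at hbody
  have hconcl := (hstep r hr hr').mem_force (forces_insert.2 ⟨?_, hΓρ⟩) hΔρ
  · rw [Interp.override_pos _ _ hr', hF _ hr']
    have hargs : (fun i => (r.instArgs (fun i => Tm.obj (ys r i)) i).subst ρ') =
        fun i => (r.args i).subst (ρ.append s) := by
      funext i
      rw [DefRule.instArgs_subst, hρs]
      exact (Tm.subst_congr (r.args i) (ρ.append s) (ρ'.append s)
        (fun x hx => hΦρ x (hrsub (Or.inl (Set.mem_iUnion.2 ⟨i, hx⟩)))) happ).symm
    have happ' := FOID.force_app I (F r.headPred) (r.instArgs fun i => Tm.obj (ys r i)) ρ'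
    have hval' := congrArg ((F r.headPred).predVal I fun x => ρ' (Sum.inl x)).val hargs
    exact hval'.subset (happ'.subset hconcl)
  · rw [FOID.force_toFOID I true, FO.force_repl I Ps F (fun x => ρ' (Sum.inl x)) _ _ _ fun _ => rfl,
      DefRule.force_instBody, hρs]
    exact hbody

/-- Cut is sound for every cut formula, so `C` plays no role and no property of `I` beyond
regularity and extensionality is needed. -/
theorem Derives.holds {C : Set (FOID L α 0)} (I : Interp E) {Γ Δ : Set (FOID L α 0)}
    (h : Derives C Γ Δ) : Holds I Γ Δ := by
  induction h with
  | ax h =>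
    intro ρ p hΓ hΔ
    rcases h with ⟨φ, h1, h2⟩ | h | h
    · exact hΔ φ h2 p le_rfl (hΓ φ h1)
    · exact hΓ _ h
    · exact hΔ _ h p le_rfl trivial
  | wk h1 h2 _ ih =>
    exact fun ρ p hΓ hΔ => ih ρ p (fun φ hφ => hΓ φ (h1 hφ)) (fun φ hφ => hΔ φ (h2 hφ))
  | subst x t _ ih =>
    intro ρ p hΓ hΔ
    refine ih (Sub.comp (Sum.elim (fun z => open Classical in if z = x then t else Tm.obj z)
      Tm.bd : Sub L α 0 0) ρ) p (fun φ hφ => ?_) (fun φ hφ => ?_)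
    · have := hΓ _ ⟨φ, hφ, rfl⟩
      rwa [FOID.repl₁, FOID.force_subst] at this
    · have := hΔ _ ⟨φ, hφ, rfl⟩
      rwa [FOID.repl₁, FOID.force_subst] at this
  | cut φ _ _ _ ih1 ih2 =>
    exact fun ρ p hΓ hΔ => ih2 ρ p (forces_insert.2 ⟨ih1.mem_force hΓ hΔ, hΓ⟩) hΔ
  | negL _ ih =>
    intro ρ p hΓ hΔ
    obtain ⟨h1, hΓ⟩ := forces_insert.1 hΓ
    exact h1 p le_rfl (ih.mem_force hΓ hΔ)
  | negR _ ih =>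
    intro ρ p hΓ hΔ
    obtain ⟨h1, hΔ⟩ := refutes_insert.1 hΔ
    exact h1 p le_rfl (ih.mem_notS hΓ hΔ)
  | orL _ _ ih1 ih2 =>
    intro ρ p hΓ hΔ
    obtain ⟨h1, hΓ⟩ := forces_insert.1 hΓ
    exact h1 p le_rfl ⟨ih1.mem_notS hΓ hΔ, ih2.mem_notS hΓ hΔ⟩
  | orR _ ih =>
    intro ρ p hΓ hΔ
    obtain ⟨h1, hΔ⟩ := refutes_insert.1 hΔ
    refine ih ρ p hΓ (refutes_insert.2 ⟨fun q hq hq' => h1 q hq ?_,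
      refutes_insert.2 ⟨fun q hq hq' => h1 q hq ?_, hΔ⟩⟩)
    · exact mem_orS_left (FOID.force_regular I _ ρ) hq'
    · exact mem_orS_right (FOID.force_regular I _ ρ) hq'
  | andL _ ih =>
    intro ρ p hΓ hΔ
    obtain ⟨h1, hΓ⟩ := forces_insert.1 hΓ
    exact ih ρ p (forces_insert.2 ⟨h1.1, forces_insert.2 ⟨h1.2, hΓ⟩⟩) hΔ
  | andR _ _ ih1 ih2 =>
    intro ρ p hΓ hΔ
    obtain ⟨h1, hΔ⟩ := refutes_insert.1 hΔ
    exact h1 p le_rfl ⟨ih1.mem_force hΓ hΔ, ih2.mem_force hΓ hΔ⟩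
  | impL _ _ ih1 ih2 =>
    intro ρ p hΓ hΔ
    obtain ⟨h1, hΓ⟩ := forces_insert.1 hΓ
    exact ih2.mem_notS hΓ hΔ p le_rfl (h1 p le_rfl (ih1.mem_force hΓ hΔ))
  | impR _ ih =>
    intro ρ p hΓ hΔ
    obtain ⟨h1, hΔ⟩ := refutes_insert.1 hΔ
    exact h1 p le_rfl fun q hq hq' =>
      ih.mem_force (forces_insert.2 ⟨hq', hΓ.lower hq⟩) (hΔ.lower hq)
  | @iffL _ _ φ ψ _ _ ih1 ih2 =>
    intro ρ p hΓ hΔ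
    obtain ⟨h1, hΓ⟩ := forces_insert.1 hΓ
    have hψ : p ∈ notS (ψ.force I ρ) := fun q hq hq' =>
      ih2 ρ q (forces_insert.2 ⟨h1.2 q hq hq', forces_insert.2 ⟨hq', hΓ.lower hq⟩⟩) (hΔ.lower hq)
    have hφ := ih1.mem_force hΓ (refutes_insert.2 ⟨hψ, hΔ⟩)
    exact hψ p le_rfl (h1.1 p le_rfl hφ)
  | iffR _ _ ih1 ih2 =>
    intro ρ p hΓ hΔ
    obtain ⟨h1, hΔ⟩ := refutes_insert.1 hΔ
    exact h1 p le_rfl ⟨fun q hq hq' =>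
      ih1.mem_force (forces_insert.2 ⟨hq', hΓ.lower hq⟩) (hΔ.lower hq), fun q hq hq' =>
      ih2.mem_force (forces_insert.2 ⟨hq', hΓ.lower hq⟩) (hΔ.lower hq)⟩
  | allL t _ ih =>
    intro ρ p hΓ hΔ
    obtain ⟨h1, hΓ⟩ := forces_insert.1 hΓ
    refine ih.mem_notS hΓ hΔ p le_rfl ?_
    rw [FOID.force_inst]
    exact Set.mem_iInter.1 h1 _
  | allR x hxΓ hxΔ hx _ ih =>
    intro ρ p hΓ hΔ
    obtain ⟨h1, hΔ⟩ := refutes_insert.1 hΔ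
    refine h1 p le_rfl (Set.mem_iInter.2 fun t => ?_)
    rw [← FOID.force_inst_obj I _ hx]
    exact ih.mem_force (hΓ.congr (ρ.set_of_notMem t hxΓ)) (hΔ.congr (ρ.set_of_notMem t hxΔ))
  | exL x hxΓ hxΔ hx _ ih =>
    intro ρ p hΓ hΔ
    obtain ⟨h1, hΓ⟩ := forces_insert.1 hΓ
    refine h1 p le_rfl (Set.mem_iInter.2 fun t => ?_)
    beta_reduce
    rw [← FOID.force_inst_obj I _ hx]
    exact ih.mem_notS (hΓ.congr (ρ.set_of_notMem t hxΓ)) (hΔ.congr (ρ.set_of_notMem t hxΔ))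
  | exR t _ ih =>
    intro ρ p hΓ hΔ
    obtain ⟨h1, hΔ⟩ := refutes_insert.1 hΔ
    have h2 := ih.mem_force hΓ hΔ
    rw [FOID.force_inst] at h2
    exact h1 p le_rfl (mem_exS _ (FOID.force_regular I _ _) h2)
  | eqL x y t s _ _ ih =>
    intro ρ p hΓ hΔ
    obtain ⟨h1, hΓ⟩ := forces_insert.1 hΓ
    have key : ∀ φ : FOID L α 0, EqBelow p ((FOID.repl₂ x t y s φ).force I ρ)
        ((FOID.repl₂ x s y t φ).force I ρ) := by
      intro φ
      rw [FOID.repl₂, FOID.repl₂, FOID.force_subst, FOID.force_subst]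
      refine φ.force_eqBelow I ?_
      rintro (z | i)
      · simp only [Sub.comp, Sum.elim_inl]
        split_ifs
        · exact h1
        · exact E.symm h1
        · exact E.refl _ _
      · exact i.elim0
    refine ih ρ p ?_ ?_
    · rintro _ ⟨φ, hφ, rfl⟩
      exact (key φ p le_rfl).1 (hΓ _ ⟨φ, hφ, rfl⟩)
    · rintro _ ⟨φ, hφ, rfl⟩
      exact ((key φ).notS p le_rfl).1 (hΔ _ ⟨φ, hφ, rfl⟩)
  | eqR t =>
    intro ρ p _ hΔ
    exact (refutes_insert.1 hΔ).1 p le_rfl (E.refl p _)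
  | defR Φ r s hr _ ih => exact Holds.defR Φ r s hr ih
  | defL Φ Ps F ys P ts hPs hP hinj hfresh _ _ ih1 ih2 =>
    exact Holds.defL Φ Ps F ys P ts hPs hP hinj hfresh ih1 ih2

end Soundness

/-! ### Underivable sequents as conditions -/

section Conditions

variable {L : FirstOrder.Language.{u, v}} {α : Type w} {C Θ : Set (FOID L α 0)}

/-- Finite underivable sequents whose antecedent contains `Θ`. -/
structure Cond (C Θ : Set (FOID L α 0)) where
  left : Set (FOID L α 0)
  right : Set (FOID L α 0)
  left_finite : left.Finite
  right_finite : right.Finite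
  base : Θ ⊆ left
  underivable : ¬ Derives C left right

/-- As usual in forcing, smaller means stronger: `q ≤ p` holds when `q` extends the sequent `p`. -/
instance : Preorder (Cond C Θ) where
  le q p := p.left ⊆ q.left ∧ p.right ⊆ q.right
  le_refl _ := ⟨Set.Subset.rfl, Set.Subset.rfl⟩
  le_trans _ _ _ h h' := ⟨h'.1.trans h.1, h'.2.trans h.2⟩

variable {p q : Cond C Θ} {φ ψ : FOID L α 0}

/-- If the extended sequent were underivable, it would itself be a condition below `p`. This lemma
and the next two turn facts about all extensions into derivations, to which rules of the calculus
can be applied. -/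
theorem Cond.derives_insert_left (h : ∀ q ≤ p, φ ∉ q.left) :
    Derives C (insert φ p.left) p.right := by
  by_contra hd
  exact h ⟨_, _, p.left_finite.insert φ, p.right_finite, p.base.trans (Set.subset_insert _ _), hd⟩
    ⟨Set.subset_insert _ _, Set.Subset.rfl⟩ (Set.mem_insert _ _)

theorem Cond.derives_insert_right (h : ∀ q ≤ p, φ ∉ q.right) :
    Derives C p.left (insert φ p.right) := by
  by_contra hd
  exact h ⟨_, _, p.left_finite, p.right_finite.insert φ, p.base, hd⟩
    ⟨Set.Subset.rfl, Set.subset_insert _ _⟩ (Set.mem_insert _ _)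

theorem Cond.derives_insert_insert (h : ∀ q ≤ p, φ ∈ q.left → ψ ∉ q.right) :
    Derives C (insert φ p.left) (insert ψ p.right) := by
  by_contra hd
  exact h ⟨_, _, p.left_finite.insert φ, p.right_finite.insert ψ,
    p.base.trans (Set.subset_insert _ _), hd⟩
    ⟨Set.subset_insert _ _, Set.subset_insert _ _⟩ (Set.mem_insert _ _) (Set.mem_insert _ _)

/-- Contraction is built into sets: a principal formula that already belongs to the sequent adds
nothing. -/
theorem Cond.false_of_left (h : φ ∈ p.left) (hd : Derives C (insert φ p.left) p.right) : False :=
  p.underivable (Set.insert_eq_of_mem h ▸ hd)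

theorem Cond.false_of_right (h : φ ∈ p.right) (hd : Derives C p.left (insert φ p.right)) : False :=
  p.underivable (Set.insert_eq_of_mem h ▸ hd)

/-! ### Exchangeability of terms as equality -/

theorem FOID.repl₂_eq_self (φ : FOID L α 0) {x y : α} (hx : x ∉ φ.objs) (hy : y ∉ φ.objs)
    (t s : Tm L α 0) : φ.repl₂ x t y s = φ := by
  refine (φ.subst_congr _ (Sub.ident L α 0) (fun z hz => ?_) fun i => i.elim0).trans φ.subst_id
  have h1 : z ≠ x := ne_of_mem_of_not_mem hz hx
  have h2 : z ≠ y := ne_of_mem_of_not_mem hz hy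
  simp [h1, h2, Sub.ident, Tm.obj]

theorem FOID.repl₂_image_eq_self {Γ : Set (FOID L α 0)} {x y : α} (hx : x ∉ free Γ)
    (hy : y ∉ free Γ) (t s : Tm L α 0) : repl₂ x t y s '' Γ = Γ := by
  refine (Set.image_congr fun φ hφ => ?_).trans (Set.image_id Γ)
  exact φ.repl₂_eq_self (fun h => hx (Set.mem_biUnion hφ h)) (fun h => hy (Set.mem_biUnion hφ h)) t s

theorem FO.app_subst {k n m : ℕ} (φ : FO L α k) (s : Fin k → Tm L α n) (σ : Sub L α n m) :
    (φ.app s).subst σ =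
      φ.subst (Sum.elim (fun x => σ (Sum.inl x)) fun i => (s i).subst σ) := by
  rw [FO.app, FO.subst_subst]
  congr 1
  funext a
  rcases a with x | i <;> rfl

theorem FO.subst_app {k n : ℕ} (φ : FO L α k) (s : Fin k → Tm L α n) (ts : Fin n → Tm L α 0) :
    FO.app (φ.subst (Sum.elim Tm.obj s)) ts =
      φ.app fun i => (s i).subst (Sum.elim Tm.obj ts : Sub L α n 0) := by
  rw [FO.app, FO.subst_subst, FO.app]
  congr 1
  funext a
  rcases a with x | i <;> rfl

/-- A term regarded as a term with `k` bound object symbols in scope. -/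
def Tm.weaken (k : ℕ) (t : Tm L α 0) : Tm L α k :=
  t.subst (Sum.elim Tm.obj fun i => i.elim0)

theorem Tm.weaken_subst {k : ℕ} (t : Tm L α 0) (s : Fin k → Tm L α 0) :
    (t.weaken k).subst (Sum.elim Tm.obj s : Sub L α k 0) = t := by
  rw [Tm.weaken, Tm.subst_subst]
  convert t.subst_id using 2
  funext a
  rcases a with x | i
  · rfl
  · exact i.elim0

/-- The rule (=L) swaps `t` and `s` at two symbols `x`, `y`. With both fresh, only the formula in
question changes; marking the place by `y` gives one direction and marking it by `x` the other, so a
single orientation of the equation suffices. -/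
theorem derives_replace [Infinite α] {Γ Δ : Set (FOID L α 0)} (hΓ : Γ.Finite) (hΔ : Δ.Finite)
    {t s : Tm L α 0} (h : FOID.equal t s ∈ Γ) (φ : FO L α 1) :
    Derives C Γ (insert (φ.app fun _ => t).toFOID Δ) ↔
      Derives C Γ (insert (φ.app fun _ => s).toFOID Δ) := by
  classical
  have hS : (FOID.free Γ ∪ FOID.free Δ ∪ φ.objs).Finite :=
    ((FOID.free_finite hΓ).union (FOID.free_finite hΔ)).union φ.objs_finite
  obtain ⟨x, hx⟩ := hS.exists_notMem
  obtain ⟨y, hy⟩ := (hS.insert x).exists_notMem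
  simp only [Set.mem_insert_iff, Set.mem_union, not_or] at hx hy
  obtain ⟨⟨hxΓ, hxΔ⟩, hxφ⟩ := hx
  obtain ⟨hyx, ⟨hyΓ, hyΔ⟩, hyφ⟩ := hy
  have key : ∀ (z : α) (a b : Tm L α 0) (c : Tm L α 0),
      (if z = x then a else if z = y then b else Tm.obj z) = c →
      FOID.repl₂ x a y b '' insert (φ.app fun _ => Tm.obj z).toFOID Δ =
        insert (φ.app fun _ => c).toFOID Δ := by
    intro z a b c hc
    rw [Set.image_insert_eq, FOID.repl₂_image_eq_self hxΔ hyΔ, FOID.repl₂, FO.toFOID_subst,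
      FO.app_subst]
    congr 2
    refine FO.subst_congr φ _ _ (fun z' hz' => ?_) fun i => ?_
    · have h1 : z' ≠ x := ne_of_mem_of_not_mem hz' hxφ
      have h2 : z' ≠ y := ne_of_mem_of_not_mem hz' hyφ
      simp [h1, h2]
    · simpa using hc
  have hx' : ∀ a b : Tm L α 0, (if x = x then a else if x = y then b else Tm.obj x) = a := by simp
  have hy' : ∀ a b : Tm L α 0, (if y = x then a else if y = y then b else Tm.obj y) = b := by
    simp [hyx]
  constructor
  · intro hd
    have := Derives.eqL (C := C) (Γ := Γ) (Δ := insert (φ.app fun _ => Tm.obj y).toFOID Δ) x y t s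
      (Ne.symm hyx)
    rw [key y s t t (hy' _ _), key y t s s (hy' _ _), FOID.repl₂_image_eq_self hxΓ hyΓ,
      FOID.repl₂_image_eq_self hxΓ hyΓ, Set.insert_eq_of_mem h] at this
    exact this hd
  · intro hd
    have := Derives.eqL (C := C) (Γ := Γ) (Δ := insert (φ.app fun _ => Tm.obj x).toFOID Δ) x y t s
      (Ne.symm hyx)
    rw [key x s t s (hx' _ _), key x t s t (hx' _ _), FOID.repl₂_image_eq_self hxΓ hyΓ,
      FOID.repl₂_image_eq_self hxΓ hyΓ, Set.insert_eq_of_mem h] at this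
    exact this hd

/-- The conditions below which `t` and `s` may be exchanged in succedents. -/
def exchangeable (C Θ : Set (FOID L α 0)) (t s : Tm L α 0) : Set (Cond C Θ) :=
  {p | ∀ q ≤ p, ∀ φ : FO L α 1,
    (Derives C q.left (insert (φ.app fun _ => t).toFOID q.right) ↔
      Derives C q.left (insert (φ.app fun _ => s).toFOID q.right))}

theorem exchangeable_symm {t s : Tm L α 0} (h : p ∈ exchangeable C Θ t s) :
    p ∈ exchangeable C Θ s t :=
  fun q hq φ => (h q hq φ).symm

/-- An extension with `φ(s)` on the right could be extended further to an exchangeable condition;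
there the weakened derivation for `φ(t)` becomes one for `φ(s)`, which is already present. Hence no
such extension exists. -/
theorem derives_of_dense_exchangeable {t s : Tm L α 0}
    (h : ∀ q ≤ p, ∃ r ≤ q, r ∈ exchangeable C Θ t s) (φ : FO L α 1)
    (hd : Derives C p.left (insert (φ.app fun _ => t).toFOID p.right)) :
    Derives C p.left (insert (φ.app fun _ => s).toFOID p.right) := by
  refine Cond.derives_insert_right fun q hq hq' => ?_
  obtain ⟨r, hr, hr'⟩ := h q hq
  refine Cond.false_of_right (hr.2 hq') ((hr' r le_rfl φ).1 (hd.wk ?_ ?_))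
  · exact (hr.trans hq).1
  · exact Set.insert_subset_insert (hr.trans hq).2

theorem exchangeable_regular (t s : Tm L α 0) : IsRegular (exchangeable C Θ t s) where
  lower hq hp r hr := hp r (hr.trans hq)
  dense h _ hq φ :=
    ⟨derives_of_dense_exchangeable (fun r hr => h r (hr.trans hq)) φ,
      derives_of_dense_exchangeable (fun r hr =>
        let ⟨r', hr', h'⟩ := h r (hr.trans hq)
        ⟨r', hr', exchangeable_symm h'⟩) φ⟩

/-- The components are exchanged one at a time; `S` is the set of those already exchanged. -/
theorem derives_exchange_tuple {k : ℕ} {ts ss : Fin k → Tm L α 0}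
    (h : ∀ i, p ∈ exchangeable C Θ (ts i) (ss i)) (hq : q ≤ p) (φ : FO L α k) :
    Derives C q.left (insert (φ.app ts).toFOID q.right) ↔
      Derives C q.left (insert (φ.app ss).toFOID q.right) := by
  have key : ∀ S : Finset (Fin k), Derives C q.left (insert (φ.app ts).toFOID q.right) ↔
      Derives C q.left (insert (φ.app fun i => if i ∈ S then ss i else ts i).toFOID q.right) := by
    intro S
    induction S using Finset.induction_on with
    | empty => simp
    | insert j S hj ih =>
      -- The context `χ` leaves only component `j` open and fixes all others at their current terms.
      let χ : FO L α 1 := φ.subst (Sum.elim Tm.obj fun i =>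
        if i = j then Tm.bd 0 else (if i ∈ S then ss i else ts i).weaken 1)
      have hχ : ∀ a : Tm L α 0, (χ.app fun _ => a) =
          φ.app fun i => if i = j then a else if i ∈ S then ss i else ts i := by
        intro a
        rw [FO.subst_app]
        congr 1
        funext i
        by_cases hi : i = j
        · simp only [if_pos hi]; rfl
        · simp only [if_neg hi]; exact Tm.weaken_subst _ _
      have h' := h j q hq χ
      rw [hχ, hχ] at h'
      rw [ih]
      convert h' using 6 with i i
      · by_cases hi : i = j
        · subst hi; simp [hj]
        · simp [hi]
      · by_cases hi : i = j
        · subst hi; simp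
        · simp [hi]
  simpa using key Finset.univ

/-- The interpretation of equality by exchangeability. -/
def condEq (C Θ : Set (FOID L α 0)) : EqInterp L α (Cond C Θ) where
  val := exchangeable C Θ
  regular := exchangeable_regular
  refl _ _ _ _ _ := Iff.rfl
  symm := exchangeable_symm
  -- Transitivity is composition of equivalences between derivability statements, so no cut on
  -- equations is required.
  trans h h' q hq φ := (h q hq φ).trans (h' q hq φ)
  congr {p k} f ts ss h q hq φ := by
    have key : ∀ as : Fin k → Tm L α 0,
        (φ.subst (Sum.elim Tm.obj fun _ => Term.func f Tm.bd : Sub L α 1 k)).app as =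
          φ.app fun _ => Term.func f as := fun as => FO.subst_app _ _ _
    rw [← key, ← key]
    exact derives_exchange_tuple h hq _

/-! ### Candidates and the truth lemma -/

/-- The atom `Q(z₁, ..., zₖ)` as a formula with place holders. -/
def atomFormula (Q : Pred L) : FO L α Q.1 := FO.rel Q.2 Tm.bd

/-- `Y` is a possible interpretation of the formula `F` with place holders. -/
structure IsCandidate {k : ℕ} (F : FO L α k) (Y : PredVal (condEq C Θ) k) : Prop where
  left : ∀ {p ts}, (F.app ts).toFOID ∈ p.left → p ∈ Y.val ts
  right : ∀ {p ts}, (F.app ts).toFOID ∈ p.right → p ∉ Y.val ts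

/-- The largest possible interpretation of the predicate symbol `Q`. -/
def largest (C Θ : Set (FOID L α 0)) (Q : Pred L) : PredVal (condEq C Θ) Q.1 where
  val ts := notS {p | FOID.rel Q.2 ts ∈ p.right}
  regular ts := isRegular_notS_of_lower fun h hp => h.2 hp
  -- Membership means that adding the atom to the succedent gives a derivable sequent, a property
  -- that exchangeable terms share.
  ext {p ts ss} h hp q hq hq' := by
    refine Cond.false_of_right hq' ((derives_exchange_tuple h hq (atomFormula Q)).1 ?_)
    exact Cond.derives_insert_right fun r hr => hp r (hr.trans hq)

theorem isCandidate_largest (Q : Pred L) : IsCandidate (atomFormula Q) (largest C Θ Q) where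
  left h q hq hq' := q.underivable (.ax (Or.inl ⟨_, hq.1 h, hq'⟩))
  right h hp := hp _ le_rfl h

theorem FO.inst_subst_lift {n : ℕ} (φ : FO L α (n + 1)) (σ : Sub L α n 0) (t : Tm L α 0) :
    (φ.subst σ.lift).toFOID.inst t = (φ.subst (σ.snoc t)).toFOID := by
  have : (Sum.elim Tm.obj fun _ => t : Sub L α 1 0) = (Sub.ident L α 0).snoc t :=
    elim_fin_one (Sub.ident L α 0) t
  rw [FOID.inst, this, FO.toFOID_subst, FO.subst_subst, Sub.lift_comp_snoc, Sub.comp_id]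

theorem Cond.exists_fresh [Infinite α] (p : Cond C Θ) (φ : FOID L α 1) :
    ∃ x, x ∉ FOID.free p.left ∧ x ∉ FOID.free p.right ∧ x ∉ φ.objs := by
  obtain ⟨x, hx⟩ := (((FOID.free_finite p.left_finite).union
    (FOID.free_finite p.right_finite)).union φ.objs_finite).exists_notMem
  simp only [Set.mem_union, not_or] at hx
  exact ⟨x, hx.1.1, hx.1.2, hx.2⟩

/-- Every condition forces the members of its antecedent and none of those of its succedent. -/
theorem FO.truth [Infinite α] {I : Bool → Interp (condEq C Θ)}
    (hI : ∀ b Q, IsCandidate (atomFormula Q) (I b Q)) {n : ℕ} (φ : FO L α n) (σ : Sub L α n 0) :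
    (∀ b, ∀ p : Cond C Θ, (φ.subst σ).toFOID ∈ p.left → p ∈ φ.force I b σ) ∧
      ∀ b, ∀ p : Cond C Θ, (φ.subst σ).toFOID ∈ p.right → p ∉ φ.force I b σ := by
  have reg := fun (b : Bool) {n : ℕ} (φ : FO L α n) σ => FO.force_regular I b φ σ
  induction φ with
  | verum => exact ⟨fun _ _ _ => trivial, fun _ p h => (p.underivable (.ax (Or.inr (Or.inr h)))).elim⟩
  | falsum => exact ⟨fun _ p h => p.underivable (.ax (Or.inr (Or.inl h))), fun _ _ _ h => h⟩
  | equal t s =>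
    refine ⟨fun _ p h q hq φ => ?_, fun _ p h hp => ?_⟩
    · exact derives_replace q.left_finite q.right_finite (hq.1 h) φ
    -- Exchange is applied in the context `t = _`: it turns the derivable `t = t` into `t = s`.
    · let χ : FO L α 1 := .equal (t.subst fun a => (σ a).weaken 1) (Tm.bd 0)
      have hχ : ∀ a, (χ.app fun _ => a) = .equal (t.subst σ) a := by
        intro a
        change FO.equal _ _ = _
        congr 1
        rw [Tm.subst_subst]
        congr 1
        funext b
        exact Tm.weaken_subst _ _
      have h' := (hp p le_rfl χ).1
      rw [hχ, hχ] at h'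
      exact Cond.false_of_right h (h' (.eqR _))
  | rel P ts => exact ⟨fun b p h => (hI b ⟨_, P⟩).left h, fun b p h => (hI b ⟨_, P⟩).right h⟩
  | neg φ ih =>
    obtain ⟨ihL, ihR⟩ := ih σ
    refine ⟨fun b p h q hq hq' => ?_, fun b p h hp => ?_⟩
    · refine Cond.false_of_left (hq.1 h) (.negL (Cond.derives_insert_right fun r hr hr' => ?_))
      exact ihR _ r hr' ((reg _ _ _).lower hr hq')
    · refine Cond.false_of_right h (.negR (Cond.derives_insert_left fun q hq hq' => ?_))
      exact hp q hq (ihL _ q hq')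
  | and φ ψ ih ih' =>
    obtain ⟨ihL, ihR⟩ := ih σ
    obtain ⟨ihL', ihR'⟩ := ih' σ
    refine ⟨fun b p h => ⟨(reg _ _ _).dense fun q hq => ?_, (reg _ _ _).dense fun q hq => ?_⟩,
      fun b p h hp => ?_⟩
    · by_contra! hc
      refine Cond.false_of_left (hq.1 h) (.andL (Derives.wk ?_ Set.Subset.rfl
        (Cond.derives_insert_left fun r hr hr' => hc r hr (ihL _ r hr'))))
      exact Set.insert_subset_insert (Set.subset_insert _ _)
    · by_contra! hc
      refine Cond.false_of_left (hq.1 h) (.andL (Derives.wk ?_ Set.Subset.rfl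
        (Cond.derives_insert_left fun r hr hr' => hc r hr (ihL' _ r hr'))))
      exact Set.subset_insert _ _
    · refine Cond.false_of_right h (.andR (Cond.derives_insert_right fun q hq hq' => ?_)
        (Cond.derives_insert_right fun q hq hq' => ?_))
      · exact ihR _ q hq' ((reg _ _ _).lower hq hp.1)
      · exact ihR' _ q hq' ((reg _ _ _).lower hq hp.2)
  | or φ ψ ih ih' =>
    obtain ⟨ihL, ihR⟩ := ih σ
    obtain ⟨ihL', ihR'⟩ := ih' σ
    refine ⟨fun b p h q hq hq' => ?_, fun b p h hp => ?_⟩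
    · refine Cond.false_of_left (hq.1 h) (.orL (Cond.derives_insert_left fun r hr hr' => ?_)
        (Cond.derives_insert_left fun r hr hr' => ?_))
      · exact hq'.1 r hr (ihL _ r hr')
      · exact hq'.2 r hr (ihL' _ r hr')
    -- The premise has both disjuncts on the right. They are added in two successive extensions,
    -- after which neither disjunct can be forced.
    · refine Cond.false_of_right h (.orR (Derives.wk Set.Subset.rfl
        (Set.insert_subset_insert (Set.subset_insert _ _))
        (Cond.derives_insert_right fun q hq hq' => ?_)))
      refine Cond.false_of_right (hq.2 h) (.orR (Derives.wk Set.Subset.rfl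
        (Set.subset_insert _ _) (Cond.derives_insert_right fun r hr hr' => ?_)))
      exact hp r (hr.trans hq) ⟨fun r' h' => ihR _ r' ((h'.trans hr).2 hq'),
        fun r' h' => ihR' _ r' (h'.2 hr')⟩
  | imp φ ψ ih ih' =>
    obtain ⟨ihL, ihR⟩ := ih σ
    obtain ⟨ihL', ihR'⟩ := ih' σ
    refine ⟨fun b p h q hq hq' => (reg _ _ _).dense fun r hr => ?_, fun b p h hp => ?_⟩
    · by_contra! hc
      refine Cond.false_of_left ((hr.trans hq).1 h) (.impL
        (Cond.derives_insert_right fun r' h' hr' => ?_)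
        (Cond.derives_insert_left fun r' h' hr' => hc r' h' (ihL' _ r' hr')))
      exact ihR _ r' hr' ((reg _ _ _).lower (h'.trans hr) hq')
    · refine Cond.false_of_right h (.impR (Cond.derives_insert_insert fun q hq h1 h2 => ?_))
      exact ihR' _ q h2 (hp q hq (ihL _ q h1))
  | iff φ ψ ih ih' =>
    obtain ⟨ihL, ihR⟩ := ih σ
    obtain ⟨ihL', ihR'⟩ := ih' σ
    refine ⟨fun b p h => ⟨fun q hq hq' => (reg _ _ _).dense fun r hr => ?_,
      fun q hq hq' => (reg _ _ _).dense fun r hr => ?_⟩, fun b p h hp => ?_⟩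
    · by_contra! hc
      refine Cond.false_of_left ((hr.trans hq).1 h) (.iffL
        (Derives.wk Set.Subset.rfl (Set.insert_subset_insert (Set.subset_insert _ _))
          (Cond.derives_insert_right fun r' h' hr' => ?_))
        (Derives.wk (Set.subset_insert _ _) Set.Subset.rfl
          (Cond.derives_insert_left fun r' h' hr' => hc r' h' (ihL' _ r' hr'))))
      exact ihR _ r' hr' ((reg _ _ _).lower (h'.trans hr) hq')
    · by_contra! hc
      refine Cond.false_of_left ((hr.trans hq).1 h) (.iffL
        (Derives.wk Set.Subset.rfl (Set.subset_insert _ _)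
          (Cond.derives_insert_right fun r' h' hr' => ?_))
        (Derives.wk (Set.insert_subset_insert (Set.subset_insert _ _)) Set.Subset.rfl
          (Cond.derives_insert_left fun r' h' hr' => hc r' h' (ihL _ r' hr'))))
      exact ihR' _ r' hr' ((reg _ _ _).lower (h'.trans hr) hq')
    · refine Cond.false_of_right h (.iffR (Cond.derives_insert_insert fun q hq h1 h2 => ?_)
        (Cond.derives_insert_insert fun q hq h1 h2 => ?_))
      · exact ihR' _ q h2 (hp.1 q hq (ihL _ q h1))
      · exact ihR _ q h2 (hp.2 q hq (ihL' _ q h1))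
  | all φ ih =>
    refine ⟨fun b p h => Set.mem_iInter.2 fun t => (reg _ _ _).dense fun q hq => ?_,
      fun b p h hp => ?_⟩
    · by_contra! hc
      refine Cond.false_of_left (hq.1 h) (.allL t (Cond.derives_insert_left fun r hr hr' => ?_))
      rw [FO.inst_subst_lift] at hr'
      exact hc r hr ((ih _).1 _ r hr')
    -- The universe consists of all terms, so a symbol fresh for the finite sequent is one of the
    -- values at which the quantified formula is forced.
    · obtain ⟨x, h1, h2, h3⟩ := p.exists_fresh (φ.subst σ.lift).toFOID
      refine Cond.false_of_right h (.allR x h1 h2 h3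
        (Cond.derives_insert_right fun q hq hq' => ?_))
      rw [FO.inst_subst_lift] at hq'
      exact (ih _).2 _ q hq' ((reg _ _ _).lower hq (Set.mem_iInter.1 hp _))
  | ex φ ih =>
    refine ⟨fun b p h q hq hq' => ?_, fun b p h hp => ?_⟩
    · obtain ⟨x, h1, h2, h3⟩ := q.exists_fresh (φ.subst σ.lift).toFOID
      refine Cond.false_of_left (hq.1 h) (.exL x h1 h2 h3
        (Cond.derives_insert_left fun r hr hr' => ?_))
      rw [FO.inst_subst_lift] at hr'
      exact Set.mem_iInter.1 hq' _ r hr ((ih _).1 _ r hr')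
    · refine hp p le_rfl (Set.mem_iInter.2 fun t q hq hq' => ?_)
      refine Cond.false_of_right (hq.2 h) (.exR t (Cond.derives_insert_right fun r hr hr' => ?_))
      rw [FO.inst_subst_lift] at hr'
      exact (ih _).2 _ r hr' ((reg _ _ _).lower hr hq')

/-- By the truth lemma, every first-order definable predicate is a candidate for its defining
formula with the parameters filled in. Quantification over candidates therefore covers all
first-order induction hypotheses. -/
theorem isCandidate_predVal [Infinite α] {I : Interp (condEq C Θ)}
    (hI : ∀ Q, IsCandidate (atomFormula Q) (I Q)) {k : ℕ} (F : FO L α k) (ρ : α → Tm L α 0) :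
    IsCandidate (F.subst (Sum.elim (fun x => (ρ x).weaken k) Tm.bd))
      (F.predVal I ρ) := by
  have key : ∀ ts : Fin k → Tm L α 0,
      FO.app (F.subst (Sum.elim (fun x => (ρ x).weaken k) Tm.bd)) ts =
        F.subst (Sum.elim ρ ts) := by
    intro ts
    rw [FO.app, FO.subst_subst]
    congr 1
    funext a
    rcases a with x | i
    · exact Tm.weaken_subst _ _
    · rfl
  have := fun ts => FO.truth (I := fun _ => I) (fun _ => hI) F (Sum.elim ρ ts)
  exact ⟨fun {p ts} h => (this ts).1 true p (key ts ▸ h),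
    fun {p ts} h => (this ts).2 true p (key ts ▸ h)⟩

/-- Here `Y Q` is any candidate for `F Q`, not necessarily its value under `B`, so `FO.truth` does
not apply to the replaced formula. For literal combinations the left half of the argument suffices:
negated atoms are not replaced and are read in `B`. -/
theorem FO.IsLiteralCombination.truth_repl [Infinite α] {B Y : Interp (condEq C Θ)}
    (hB : ∀ Q, IsCandidate (atomFormula Q) (B Q)) {Ps : Set (Pred L)}
    {F : (Q : Pred L) → FO L α Q.1} (hY : ∀ Q ∈ Ps, IsCandidate (F Q) (Y Q)) {φ : FO L α 0}
    (hφ : φ.IsLiteralCombination) {p : Cond C Θ} (h : (φ.repl Ps F true).toFOID ∈ p.left) :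
    p ∈ φ.force (dual (B.override Ps Y) B) true (Sub.ident L α 0) := by
  have reg := fun φ : FO L α 0 =>
    FO.force_regular (dual (B.override Ps Y) B) true φ (Sub.ident L α 0)
  have htruth := fun φ : FO L α 0 =>
    FO.truth (I := fun _ => B) (fun _ => hB) φ (Sub.ident L α 0)
  simp only [FO.subst_id] at htruth
  induction hφ generalizing p with
  | pos ha =>
    cases ha with
    | verum => exact (htruth _).1 true p h
    | falsum => exact (htruth _).1 true p h
    | equal t s => exact (htruth _).1 true p h
    | @rel k P ts =>
      by_cases hP : (⟨k, P⟩ : Pred L) ∈ Ps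
      · simp only [FO.repl, if_pos hP] at h
        simp only [FO.force, dual, Interp.override_pos _ _ hP, Tm.subst_id]
        exact (hY _ hP).left h
      · simp only [FO.repl, if_neg hP] at h
        simp only [FO.force, dual, Interp.override_neg _ _ hP, Tm.subst_id]
        exact (hB _).left h
  | neg ha =>
    cases ha with
    | verum => exact (htruth (.neg .verum)).1 true p h
    | falsum => exact (htruth (.neg .falsum)).1 true p h
    | equal t s => exact (htruth (.neg (.equal t s))).1 true p h
    | rel P ts => exact (htruth (.neg (.rel P ts))).1 true p h
  | and _ _ ih ih' =>
    refine ⟨(reg _).dense fun q hq => ?_, (reg _).dense fun q hq => ?_⟩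
    · by_contra! hc
      refine Cond.false_of_left (hq.1 h) (.andL (Derives.wk ?_ Set.Subset.rfl
        (Cond.derives_insert_left fun r hr hr' => hc r hr (ih hr'))))
      exact Set.insert_subset_insert (Set.subset_insert _ _)
    · by_contra! hc
      refine Cond.false_of_left (hq.1 h) (.andL (Derives.wk ?_ Set.Subset.rfl
        (Cond.derives_insert_left fun r hr hr' => hc r hr (ih' hr'))))
      exact Set.subset_insert _ _
  | or _ _ ih ih' =>
    intro q hq hq'
    refine Cond.false_of_left (hq.1 h) (.orL (Cond.derives_insert_left fun r hr hr' => ?_)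
      (Cond.derives_insert_left fun r hr hr' => ?_))
    · exact hq'.1 r hr (ih hr')
    · exact hq'.2 r hr (ih' hr')

/-- Bodies are monotone at positive and antitone at negative occurrences. The comparison is needed
only below `p` and for predicates that occur, which is what induction on the rank can provide. -/
theorem FO.IsLiteralCombination.force_mono {K : Type*} [Preorder K] {E : EqInterp L α K}
    {A B A' B' : Interp E} {n : ℕ} {φ : FO L α n} (hφ : φ.IsLiteralCombination) {p : K}
    (hpos : ∀ Q ∈ φ.occ true, ∀ ts, ∀ q ≤ p, q ∈ (A Q).val ts → q ∈ (A' Q).val ts)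
    (hneg : ∀ Q ∈ φ.occ false, ∀ ts, ∀ q ≤ p, q ∈ (B' Q).val ts → q ∈ (B Q).val ts)
    {σ : Sub L α n 0} (h : p ∈ φ.force (dual A B) true σ) :
    p ∈ φ.force (dual A' B') true σ := by
  induction hφ generalizing p with
  | pos ha =>
    cases ha with
    | verum => exact h
    | falsum => exact h
    | equal t s => exact h
    | rel P ts => exact hpos _ rfl _ p le_rfl h
  | neg ha =>
    cases ha with
    | verum => exact h
    | falsum => exact h
    | equal t s => exact h
    | rel P ts => exact fun q hq hq' => h q hq (hneg _ rfl _ q hq hq')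
  | and _ _ ih ih' =>
    exact ⟨ih (fun Q hQ => hpos Q (Or.inl hQ)) (fun Q hQ => hneg Q (Or.inl hQ)) h.1,
      ih' (fun Q hQ => hpos Q (Or.inr hQ)) (fun Q hQ => hneg Q (Or.inr hQ)) h.2⟩
  | or _ _ ih ih' =>
    intro q hq hq'
    refine h q hq ⟨fun r hr h1 => hq'.1 r hr (ih ?_ ?_ h1), fun r hr h1 => hq'.2 r hr (ih' ?_ ?_ h1)⟩
    · exact fun Q hQ ts r' h' => hpos Q (Or.inl hQ) ts r' ((h'.trans hr).trans hq)
    · exact fun Q hQ ts r' h' => hneg Q (Or.inl hQ) ts r' ((h'.trans hr).trans hq)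
    · exact fun Q hQ ts r' h' => hpos Q (Or.inr hQ) ts r' ((h'.trans hr).trans hq)
    · exact fun Q hQ ts r' h' => hneg Q (Or.inr hQ) ts r' ((h'.trans hr).trans hq)

end Conditions

/-! ### Interpretation of the defined predicates -/

section Definitions

variable {L : FirstOrder.Language.{u, v}} {α : Type w} {C Θ : Set (FOID L α 0)}

theorem DefRule.instSub_eq {k : ℕ} (s : Fin k → Tm L α 0) :
    DefRule.instSub s = (Sub.ident L α 0).append s := by
  have h := DefRule.instSub_comp s (Sub.ident L α 0)
  rw [Sub.comp_id] at h
  simpa only [Tm.subst_id] using h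

/-- If the body of an instance of a rule is forced, then its head belongs to the largest possible
interpretation. -/
theorem mem_largest_of_body [Infinite α] {A B : Interp (condEq C Θ)}
    (hA : ∀ Q, IsCandidate (atomFormula Q) (A Q)) (hB : ∀ Q, IsCandidate (atomFormula Q) (B Q))
    {Φ : Defn L α 0} (hΦ : FOID.defn Φ ∈ Θ) {r : DefRule L α 0} (hr : r ∈ Φ)
    (s : Fin r.bound → Tm L α 0) {p : Cond C Θ}
    (h : p ∈ r.body.force (dual A B) true ((Sub.ident L α 0).append s)) :
    p ∈ (largest C Θ r.headPred).val
      fun i : Fin r.arity => (r.args i).subst ((Sub.ident L α 0).append s) := by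
  intro q hq hq'
  have hargs : r.instArgs s = fun i => (r.args i).subst ((Sub.ident L α 0).append s) := by
    funext i
    rw [DefRule.instArgs, DefRule.instSub_eq]
  have htruth := (FO.truth (I := dual A B) (fun b Q => by cases b; exacts [hB Q, hA Q]) r.body
    ((Sub.ident L α 0).append s)).2 true
  -- A forced body cannot be on the right of any extension, so adding it there gives a derivable
  -- sequent, and (def R) passes from the body to the head.
  have hd : Derives C q.left (insert (r.instBody s).toFOID q.right) :=
    Cond.derives_insert_right fun q' h' hmem => by
      rw [DefRule.instBody, DefRule.instSub_eq] at hmem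
      exact htruth q' hmem ((FO.force_regular _ _ _ _).lower (h'.trans hq) h)
  rw [← Set.insert_eq_of_mem (q.base hΦ)] at hd
  have hd' := Derives.defR Φ r s hr hd
  rw [Set.insert_eq_of_mem (q.base hΦ), hargs] at hd'
  exact Cond.false_of_right hq' hd'

/-- Possible interpretations that are closed under the rules of a definition contain every defined
atom of the antecedent. -/
theorem mem_of_closed [Infinite α] {B Y : Interp (condEq C Θ)}
    (hB : ∀ Q, IsCandidate (atomFormula Q) (B Q)) {Φ : Defn L α 0} (hΦ : FOID.defn Φ ∈ Θ)
    (hbodies : ∀ r ∈ Φ, r.body.IsLiteralCombination) {Ps : Set (Pred L)}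
    (hPs : Ps ⊆ Defn.defined Φ) {F : (Q : Pred L) → FO L α Q.1}
    (hY : ∀ Q ∈ Ps, IsCandidate (F Q) (Y Q)) {P : Pred L} (hP : P ∈ Ps)
    {ts : Fin P.1 → Tm L α 0} {p : Cond C Θ}
    (hp : p ∈ Defn.Closed Φ (Sub.ident L α 0) (B.override Ps Y) B Ps)
    (h : FOID.rel P.2 ts ∈ p.left) : p ∈ (Y P).val ts := by
  refine ((Y P).regular ts).dense fun q hq => ?_
  by_contra! hc
  have hS : (FOID.free q.left ∪ FOID.free q.right ∪ Defn.objs Φ ∪ ⋃ Q ∈ Ps, (F Q).objs).Finite :=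
    (((FOID.free_finite q.left_finite).union (FOID.free_finite q.right_finite)).union
      (Defn.objs_finite Φ)).union
        (((Defn.defined_finite Φ).subset hPs).biUnion fun Q _ => (F Q).objs_finite)
  -- One injective sequence of fresh symbols names the bound symbols of every rule.
  let e := hS.infinite_compl.natEmbedding
  refine Cond.false_of_left (hq.1 h) ?_
  have hd := Derives.defL (C := C) (Γ := q.left) (Δ := q.right) Φ Ps F
    (fun r i => (e i : α)) P ts hPs hP
    (fun r _ i j hij => Fin.ext (e.injective (Subtype.ext hij)))
    (fun r _ i => by
      have hi := (e i).2
      simp only [Set.mem_compl_iff, Set.mem_union, Set.mem_iUnion, not_or, not_exists] at hi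
      exact ⟨hi.1.1.1, hi.1.1.2, hi.1.2, hi.2⟩)
  rw [Set.insert_eq_of_mem (q.base hΦ)] at hd
  -- Each premise of (def L) is derivable because no extension violates it: a replaced body on the
  -- left is forced, so closedness puts the head into `Y`, which excludes its induction hypothesis
  -- from the right. In the last premise, having `F P` on the left would force `Y P`, against `hc`.
  refine hd (fun r hr hr' => Cond.derives_insert_insert fun q' h' h1 h2 => ?_)
    (Cond.derives_insert_left fun q' h' h1 => hc q' h' ((hY P hP).left h1))
  have hbody := FO.IsLiteralCombination.truth_repl hB hY ((hbodies r hr).subst _) h1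
  rw [DefRule.instSub_eq, FO.force_subst, Sub.comp_id] at hbody
  have hhead := hp r hr hr' _ q' (h'.trans hq) hbody
  rw [Interp.override_pos _ _ hr'] at hhead
  refine (hY _ hr').right ?_ hhead
  have hargs : (r.instArgs fun i => Tm.obj (e i : α)) = fun i =>
      (r.args i).subst ((Sub.ident L α 0).append fun i : Fin r.bound => Tm.obj (e i : α)) := by
    funext i
    rw [DefRule.instArgs, DefRule.instSub_eq]
  exact hargs ▸ h2

/-! ### Least fixed points by recursion on the rank -/

variable {ι : Type*} {W : Type*} [LinearOrder W] [WellFoundedLT W]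

/-- The defined predicates of rank `m` of a definition. -/
def Defn.block (rank : Pred L → W) (Φ : Defn L α 0) (m : W) : Set (Pred L) :=
  {Q | Q ∈ Defn.defined Φ ∧ rank Q = m}

/-- The least fixed point of the rules for the block of `P`, among the possible interpretations of
formulas, where all predicates outside the block are interpreted by `base`. -/
def blockVal (Φ : ι → Defn L α 0) (rank : Pred L → W) (base : Interp (condEq C Θ)) (P : Pred L) :
    PredVal (condEq C Θ) P.1 where
  -- The factor `largest` secures the upper bound required of a candidate. For predicates without a
  -- definition it is the whole value.
  val ts := (largest C Θ P).val ts ∩ ⋂ (i : ι) (_ : P ∈ Defn.defined (Φ i))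
    (F : (Q : Pred L) → FO L α Q.1) (Y : Interp (condEq C Θ))
    (_ : ∀ Q ∈ Defn.block rank (Φ i) (rank P), IsCandidate (F Q) (Y Q)),
    impS (Defn.Closed (Φ i) (Sub.ident L α 0)
      (base.override (Defn.block rank (Φ i) (rank P)) Y) base (Defn.block rank (Φ i) (rank P)))
      ((Y P).val ts)
  regular ts := ((largest C Θ P).regular ts).inter <| isRegular_iInter fun _ =>
    isRegular_iInter fun _ => isRegular_iInter fun _ => isRegular_iInter fun Y =>
      isRegular_iInter fun _ => (Defn.closed_regular _ _ _ _ _).impS ((Y P).regular ts)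
  ext {p ts ss} h hp := by
    refine (EqBelow.inter ((largest C Θ P).eqBelow h) ?_ p le_rfl).1 hp
    exact EqBelow.iInter fun _ => EqBelow.iInter fun _ => EqBelow.iInter fun _ =>
      EqBelow.iInter fun Y => EqBelow.iInter fun _ =>
        EqBelow.impS (fun _ _ => Iff.rfl) ((Y P).eqBelow h)

open Classical in
/-- The interpretation of all predicates, by recursion on their rank. -/
noncomputable def interp (C Θ : Set (FOID L α 0)) (Φ : ι → Defn L α 0) (rank : Pred L → W)
    (P : Pred L) : PredVal (condEq C Θ) P.1 :=
  (InvImage.wf rank wellFounded_lt).fix (C := fun P => PredVal (condEq C Θ) P.1)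
    (fun P rec => blockVal Φ rank
      -- The default is a candidate, as `mem_of_closed` needs of the base at every predicate. In
      -- ranked definitions it does not influence the rules of the block: their bodies mention only
      -- lower ranks and the block itself, which is overridden.
      (fun Q => if h : rank Q < rank P then rec Q h else largest C Θ Q) P) P

open Classical in
/-- The interpretation of the predicates of rank below `m`, extended by largest interpretations. -/
noncomputable def interpBelow (C Θ : Set (FOID L α 0)) (Φ : ι → Defn L α 0) (rank : Pred L → W)
    (m : W) : Interp (condEq C Θ) :=
  fun Q => if rank Q < m then interp C Θ Φ rank Q else largest C Θ Q

variable {Φ : ι → Defn L α 0} {rank : Pred L → W}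

theorem interp_eq (P : Pred L) :
    interp C Θ Φ rank P = blockVal Φ rank (interpBelow C Θ Φ rank (rank P)) P := by
  rw [interp, WellFounded.fix_eq]
  rfl

theorem interpBelow_of_lt {m : W} {Q : Pred L} (h : rank Q < m) :
    interpBelow C Θ Φ rank m Q = interp C Θ Φ rank Q := if_pos h

theorem mem_interp {P : Pred L} {m : W} (hm : rank P = m) {ts : Fin P.1 → Tm L α 0}
    {p : Cond C Θ} :
    p ∈ (interp C Θ Φ rank P).val ts ↔ p ∈ (largest C Θ P).val ts ∧
      ∀ i, P ∈ Defn.defined (Φ i) → ∀ (F : (Q : Pred L) → FO L α Q.1) (Y : Interp (condEq C Θ)),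
        (∀ Q ∈ Defn.block rank (Φ i) m, IsCandidate (F Q) (Y Q)) → ∀ q ≤ p,
        q ∈ Defn.Closed (Φ i) (Sub.ident L α 0)
          ((interpBelow C Θ Φ rank m).override (Defn.block rank (Φ i) m) Y)
          (interpBelow C Θ Φ rank m) (Defn.block rank (Φ i) m) → q ∈ (Y P).val ts := by
  subst hm
  rw [interp_eq]
  simp only [blockVal, Set.mem_inter_iff, Set.mem_iInter]
  rfl

/-- The bodies of the rules refer only to predicates of the same block or of lower rank, and
negatively only to predicates of lower rank. -/
structure IsRanked (Φ : ι → Defn L α 0) (rank : Pred L → W) : Prop where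
  bodies : ∀ i, ∀ r ∈ Φ i, r.body.IsLiteralCombination
  unique : ∀ {i j P}, P ∈ Defn.defined (Φ i) → P ∈ Defn.defined (Φ j) → i = j
  pos : ∀ i, ∀ r ∈ Φ i, ∀ Q ∈ r.body.occ true, rank Q < rank r.headPred ∨
    Q ∈ Defn.block rank (Φ i) (rank r.headPred)
  neg : ∀ i, ∀ r ∈ Φ i, ∀ Q ∈ r.body.occ false, rank Q < rank r.headPred

/-- The lower bound comes from (def L) through `mem_of_closed`, for each closed family in the
intersection; the upper bound comes from the factor `largest`. Induction on the rank makes the base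
a family of candidates. -/
theorem isCandidate_interp [Infinite α] (hΘ : ∀ i, FOID.defn (Φ i) ∈ Θ)
    (hΦ : IsRanked Φ rank) (P : Pred L) :
    IsCandidate (atomFormula P) (interp C Θ Φ rank P) := by
  induction hm : rank P using WellFoundedLT.induction generalizing P with
  | ind m ih =>
    have hB : ∀ Q, IsCandidate (atomFormula Q) (interpBelow C Θ Φ rank m Q) := by
      intro Q
      by_cases hQ : rank Q < m
      · rw [interpBelow_of_lt hQ]
        exact ih _ hQ Q rfl
      · rw [interpBelow, if_neg hQ]
        exact isCandidate_largest Q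
    refine ⟨fun {p ts} h => (mem_interp hm).2 ⟨(isCandidate_largest P).left h, ?_⟩,
      fun h hp => (isCandidate_largest P).right h ((mem_interp hm).1 hp).1⟩
    intro i hi F Y hY q hq hclosed
    exact mem_of_closed hB (hΘ i) (hΦ.bodies i) (fun Q hQ => hQ.1) hY ⟨hi, hm⟩ hclosed (hq.1 h)

/-- The Knaster–Tarski argument: the intersection lies below each closed family `Y`, so a body
forced by it is forced with `Y` in the block, and the head belongs to `Y`. Negative occurrences have
lower rank, where the base is already final. The factor `largest` is handled by (def R). -/
theorem closed_interp [Infinite α] (hΘ : ∀ i, FOID.defn (Φ i) ∈ Θ) (hΦ : IsRanked Φ rank)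
    (i : ι) (p : Cond C Θ) :
    p ∈ Defn.Closed (Φ i) (Sub.ident L α 0) (interp C Θ Φ rank) (interp C Θ Φ rank) Set.univ := by
  intro r hr _ s q _ hbody
  have hc := isCandidate_interp (C := C) hΘ hΦ
  refine (mem_interp (P := r.headPred) rfl).2 ⟨mem_largest_of_body hc hc (hΘ i) hr s hbody, ?_⟩
  intro j hj F Y hY q' hq' hclosed
  obtain rfl := hΦ.unique ⟨r, hr, rfl⟩ hj
  have hblock : r.headPred ∈ Defn.block rank (Φ i) (rank r.headPred) := ⟨hj, rfl⟩
  have hhead := hclosed r hr hblock s q' le_rfl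
    ((hΦ.bodies i r hr).force_mono ?_ ?_ ((FO.force_regular _ _ _ _).lower hq' hbody))
  · rwa [Interp.override_pos _ _ hblock] at hhead
  · intro Q hQ ts q'' h'' hmem
    by_cases hQb : Q ∈ Defn.block rank (Φ i) (rank r.headPred)
    · rw [Interp.override_pos _ _ hQb]
      exact ((mem_interp hQb.2).1 hmem).2 i hQb.1 F Y hY q'' le_rfl
        ((Defn.closed_regular _ _ _ _ _).lower h'' hclosed)
    · rw [Interp.override_neg _ _ hQb, interpBelow_of_lt ((hΦ.pos i r hr Q hQ).resolve_right hQb)]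
      exact hmem
  · intro Q hQ ts q'' _ hmem
    rwa [interpBelow_of_lt (hΦ.neg i r hr Q hQ)] at hmem

/-- Conjunction of two interpretations of a predicate symbol. -/
def PredVal.inter {K : Type*} [Preorder K] {E : EqInterp L α K} {k : ℕ} (Y Z : PredVal E k) :
    PredVal E k where
  val ts := Y.val ts ∩ Z.val ts
  regular ts := (Y.regular ts).inter (Z.regular ts)
  ext h hp := ⟨Y.ext h hp.1, Z.ext h hp.2⟩

/-- Used to strengthen an induction hypothesis by the defined atom itself while staying among the
candidates. -/
theorem IsCandidate.and {k : ℕ} {F G : FO L α k} {Y Z : PredVal (condEq C Θ) k}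
    (hY : IsCandidate F Y) (hZ : IsCandidate G Z) : IsCandidate (F.and G) (Y.inter Z) where
  left {p ts} h := by
    refine ⟨(Y.regular ts).dense fun q hq => ?_, (Z.regular ts).dense fun q hq => ?_⟩
    · by_contra! hc
      refine Cond.false_of_left (hq.1 h) (.andL (Derives.wk ?_ Set.Subset.rfl
        (Cond.derives_insert_left fun r hr hr' => hc r hr (hY.left hr'))))
      exact Set.insert_subset_insert (Set.subset_insert _ _)
    · by_contra! hc
      refine Cond.false_of_left (hq.1 h) (.andL (Derives.wk ?_ Set.Subset.rfl
        (Cond.derives_insert_left fun r hr hr' => hc r hr (hZ.left hr'))))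
      exact Set.subset_insert _ _
  right {p ts} h hp := by
    refine Cond.false_of_right h (.andR (Cond.derives_insert_right fun q hq hq' => ?_)
      (Cond.derives_insert_right fun q hq hq' => ?_))
    · exact hY.right hq' ((Y.regular ts).lower hq hp.1)
    · exact hZ.right hq' ((Z.regular ts).lower hq hp.2)

-- The set `Ps` may meet several blocks and contain only part of each, whereas minimality concerns
-- whole blocks. So one proceeds by induction on the rank, comparing with the family `Z` that is `Y
-- ∩ interp` on `Ps` and `interp` elsewhere. If `Z` is closed under the rules of the block,
-- minimality places `interp` inside `Z`, hence inside `Y`.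
open Classical in
theorem induction_interp [Infinite α] (hΘ : ∀ i, FOID.defn (Φ i) ∈ Θ) (hΦ : IsRanked Φ rank)
    (i : ι) (p : Cond C Θ) {Ps : Set (Pred L)} (hPs : Ps ⊆ Defn.defined (Φ i))
    {F : (Q : Pred L) → FO L α Q.1} {Y : Interp (condEq C Θ)}
    (hY : ∀ Q, IsCandidate (F Q) (Y Q)) :
    p ∈ Defn.Induction (Φ i) (Sub.ident L α 0) (interp C Θ Φ rank) Ps Y := by
  intro q _ hclosed
  suffices h : ∀ Q ∈ Ps, ∀ ts, ∀ q' ≤ q, q' ∈ (interp C Θ Φ rank Q).val ts → q' ∈ (Y Q).val ts from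
    Set.mem_iInter.2 fun Q => Set.mem_iInter.2 fun ts => h Q Q.2 ts
  intro P hP
  induction hm : rank P using WellFoundedLT.induction generalizing P with
  | ind m ih =>
    intro ts q' hq' hmem
    have hc := isCandidate_interp (C := C) hΘ hΦ
    let Z : Interp (condEq C Θ) := fun Q =>
      if Q ∈ Ps then (Y Q).inter (interp C Θ Φ rank Q) else interp C Θ Φ rank Q
    let G : (Q : Pred L) → FO L α Q.1 := fun Q =>
      if Q ∈ Ps then (F Q).and (atomFormula Q) else atomFormula Q
    have hZ : ∀ Q, IsCandidate (G Q) (Z Q) := by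
      intro Q
      by_cases hQ : Q ∈ Ps
      · simpa only [G, Z, if_pos hQ] using (hY Q).and (hc Q)
      · simpa only [G, Z, if_neg hQ] using hc Q
    have hZpos : ∀ {Q}, Q ∈ Ps → Z Q = (Y Q).inter (interp C Θ Φ rank Q) := fun h => if_pos h
    have hZI : ∀ Q ss q'', q'' ∈ (Z Q).val ss → q'' ∈ (interp C Θ Φ rank Q).val ss := by
      intro Q ss q'' h
      by_cases hQ : Q ∈ Ps
      · rw [hZpos hQ] at h
        exact h.2
      · simpa only [Z, if_neg hQ] using h
    suffices hZP : q' ∈ (Z P).val ts by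
      rw [hZpos hP] at hZP
      exact hZP.1
    refine ((mem_interp hm).1 hmem).2 i (hPs hP) G Z (fun Q _ => hZ Q) q' le_rfl ?_
    intro r hr hrm s q'' hq'' hbody
    rw [Interp.override_pos _ _ hrm]
    have hlt : ∀ Q ∈ r.body.occ false, rank Q < m := fun Q hQ => hrm.2 ▸ hΦ.neg i r hr Q hQ
    have hpos : ∀ Q ∈ r.body.occ true, rank Q < m ∨ Q ∈ Defn.block rank (Φ i) m :=
      fun Q hQ => hrm.2 ▸ hΦ.pos i r hr Q hQ
    -- Since `Z` lies below `interp`, closedness of `interp` gives the head in `interp`. For heads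
    -- in `Ps`, membership in `Y` follows from `hclosed`: block predicates in `Ps` use that `Z` lies
    -- below `Y`, those of lower rank use `ih`.
    have hI := closed_interp (C := C) hΘ hΦ i q'' r hr trivial s q'' le_rfl
      ((hΦ.bodies i r hr).force_mono ?_ ?_ hbody)
    · by_cases hrP : r.headPred ∈ Ps
      · rw [hZpos hrP]
        refine ⟨?_, hI⟩
        have hhead := hclosed r hr hrP s q'' (hq''.trans hq')
          ((hΦ.bodies i r hr).force_mono ?_ ?_ hbody)
        · rwa [Interp.override_pos _ _ hrP] at hhead
        · intro Q hQ ss q₁ hq₁ h₁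
          by_cases hQP : Q ∈ Ps
          · rw [Interp.override_pos _ _ hQP]
            rcases (Classical.em (Q ∈ Defn.block rank (Φ i) m)) with hQb | hQb
            · rw [Interp.override_pos _ _ hQb, hZpos hQP] at h₁
              exact h₁.1
            · have hQlt := (hpos Q hQ).resolve_right hQb
              rw [Interp.override_neg _ _ hQb, interpBelow_of_lt hQlt] at h₁
              exact ih _ hQlt Q hQP rfl ss q₁ (hq₁.trans (hq''.trans hq')) h₁
          · rw [Interp.override_neg _ _ hQP]
            rcases (Classical.em (Q ∈ Defn.block rank (Φ i) m)) with hQb | hQb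
            · rw [Interp.override_pos _ _ hQb] at h₁
              exact hZI Q ss q₁ h₁
            · rwa [Interp.override_neg _ _ hQb,
                interpBelow_of_lt ((hpos Q hQ).resolve_right hQb)] at h₁
        · intro Q hQ ss q₁ _ h₁
          rwa [interpBelow_of_lt (hlt Q hQ)]
      · simpa only [Z, if_neg hrP] using hI
    · intro Q hQ ss q₁ _ h₁
      rcases (Classical.em (Q ∈ Defn.block rank (Φ i) m)) with hQb | hQb
      · rw [Interp.override_pos _ _ hQb] at h₁
        exact hZI Q ss q₁ h₁
      · rwa [Interp.override_neg _ _ hQb,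
          interpBelow_of_lt ((hpos Q hQ).resolve_right hQb)] at h₁
    · intro Q hQ ss q₁ _ h₁
      rwa [interpBelow_of_lt (hlt Q hQ)]

theorem force_defn_interp [Infinite α] (hΘ : ∀ i, FOID.defn (Φ i) ∈ Θ) (hΦ : IsRanked Φ rank)
    (i : ι) (p : Cond C Θ) :
    p ∈ Defn.force (interp C Θ Φ rank) (Φ i) (Sub.ident L α 0) := by
  refine ⟨closed_interp hΘ hΦ i p, ?_⟩
  simp only [Set.mem_iInter]
  exact fun Ps hPs F ρ => induction_interp hΘ hΦ i p hPs fun Q =>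
    isCandidate_predVal (isCandidate_interp hΘ hΦ) (F Q) ρ

/-! ### Cut elimination and the rank of a canonical sequent -/

/-- Cut elimination: derivable sequents with ranked definitions are derivable with any set of cut
formulas. -/
theorem Derives.eliminate_cuts [Infinite α] {n : ℕ} {Φ : Fin n → Defn L α 0}
    (hΦ : IsRanked Φ rank) {Γ Δ : Set (FO L α 0)} (hΓ : Γ.Finite) (hΔ : Δ.Finite)
    {C C' : Set (FOID L α 0)} (h : Derives C (antecedent Γ Φ) (succedent Δ)) :
    Derives C' (antecedent Γ Φ) (succedent Δ) := by
  by_contra hd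
  let Θ : Set (FOID L α 0) := Set.range fun i => FOID.defn (Φ i)
  have hΘ : ∀ i, FOID.defn (Φ i) ∈ Θ := fun i => ⟨i, rfl⟩
  let p : Cond C' Θ := ⟨antecedent Γ Φ, succedent Δ, (hΓ.image _).union (Set.finite_range _),
    hΔ.image _, Set.subset_union_right, hd⟩
  have htruth := fun φ : FO L α 0 => FO.truth (I := fun _ => interp C' Θ Φ rank)
    (fun _ => isCandidate_interp hΘ hΦ) φ (Sub.ident L α 0)
  simp only [FO.subst_id] at htruth
  -- The underivable sequent is itself a condition; under the identity assignment it forces its left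
  -- side and refutes its right side, contradicting soundness.
  refine h.holds (interp C' Θ Φ rank) (Sub.ident L α 0) p ?_ ?_
  · rintro _ (⟨φ, hφ, rfl⟩ | ⟨i, rfl⟩)
    · rw [FOID.force_toFOID _ true]
      exact (htruth φ).1 true p (Or.inl ⟨φ, hφ, rfl⟩)
    · exact force_defn_interp hΘ hΦ i p
  · rintro _ ⟨φ, hφ, rfl⟩ q hq
    rw [FOID.force_toFOID _ true]
    exact (htruth φ).2 true q (hq.2 ⟨φ, hφ, rfl⟩)

open Classical in
/-- The lexicographic rank of a predicate: the index of the definition that defines it, followed by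
its level there. -/
noncomputable def lexRank {n : ℕ} (Φ : Fin n → Defn L α 0) (lev : Fin n → Pred L → ℕ)
    (P : Pred L) : ℕ ×ₗ ℕ :=
  -- The shift by one keeps first component `0` for undefined predicates, so they lie below all
  -- defined ones.
  if h : ∃ i, P ∈ Defn.defined (Φ i) then toLex ((h.choose : ℕ) + 1, lev h.choose P)
  else toLex (0, 0)

/-- A parameter of a definition is either undefined or defined by an earlier definition, so its
first component is smaller. Within one definition the stratification decides. -/
theorem Canonical.isRanked {n : ℕ} {Φ : Fin n → Defn L α 0} {Γ Δ : Set (FO L α 0)}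
    (h : Canonical Γ Φ Δ) {lev : Fin n → Pred L → ℕ}
    (hlev : ∀ i, Defn.IsStratification (Φ i) (lev i)) : IsRanked Φ (lexRank Φ lev) := by
  have unique : ∀ {i j P}, P ∈ Defn.defined (Φ i) → P ∈ Defn.defined (Φ j) → i = j := by
    intro i j P hi hj
    by_contra hij
    exact Set.disjoint_left.1 (h.defined_disjoint i j hij) hi hj
  have hrank : ∀ {i P}, P ∈ Defn.defined (Φ i) →
      lexRank Φ lev P = toLex ((i : ℕ) + 1, lev i P) := by
    intro i P hi
    have hex : ∃ i, P ∈ Defn.defined (Φ i) := ⟨i, hi⟩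
    rw [lexRank, dif_pos hex, unique hex.choose_spec hi]
  have hlow : ∀ i, ∀ r ∈ Φ i, ∀ Q ∈ r.body.preds, Q ∉ Defn.defined (Φ i) →
      lexRank Φ lev Q < lexRank Φ lev r.headPred := by
    intro i r hr Q hQ hQi
    by_cases hex : ∃ j, Q ∈ Defn.defined (Φ j)
    · obtain ⟨j, hj⟩ := hex
      have hji : j < i := by
        by_contra hij
        rcases (not_lt.1 hij).lt_or_eq with hlt | rfl
        · exact Set.disjoint_left.1 (h.defined_params j i hlt) hj ⟨⟨r, hr, hQ⟩, hQi⟩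
        · exact hQi hj
      rw [hrank hj, hrank ⟨r, hr, rfl⟩, Prod.Lex.toLex_lt_toLex]
      exact Or.inl (Nat.succ_lt_succ hji)
    · rw [hrank ⟨r, hr, rfl⟩, lexRank, dif_neg hex, Prod.Lex.toLex_lt_toLex]
      exact Or.inl (Nat.succ_pos _)
  refine ⟨h.bodies, unique, fun i r hr Q hQ => ?_, fun i r hr Q hQ => ?_⟩
  · by_cases hQi : Q ∈ Defn.defined (Φ i)
    · rcases ((hlev i r hr Q hQi).1 (Or.inl hQ)).lt_or_eq with hlt | heq
      · left
        rw [hrank hQi, hrank ⟨r, hr, rfl⟩, Prod.Lex.toLex_lt_toLex]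
        exact Or.inr ⟨rfl, hlt⟩
      · right
        refine ⟨hQi, ?_⟩
        rw [hrank hQi, hrank ⟨r, hr, rfl⟩, heq]
    · exact Or.inl (hlow i r hr Q (Or.inl hQ) hQi)
  · by_cases hQi : Q ∈ Defn.defined (Φ i)
    · rw [hrank hQi, hrank ⟨r, hr, rfl⟩, Prod.Lex.toLex_lt_toLex]
      exact Or.inr ⟨rfl, (hlev i r hr Q hQi).2 hQ⟩
    · exact hlow i r hr Q (Or.inr hQ) hQi

end Definitions

end SCFOID

/-- The set of elementary cut formulas is one instance of the arbitrary target set in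
`Derives.eliminate_cuts`. -/
theorem mainTheorem7 {L : FirstOrder.Language.{u, v}} {α : Type w} [Infinite α] {n : ℕ}
    (Γ Δ : Set (SCFOID.FO L α 0)) (Φ : Fin n → SCFOID.Defn L α 0)
    (hcanonical : SCFOID.Canonical Γ Φ Δ)
    (hstratified : ∀ i, SCFOID.Defn.Stratified (Φ i))
    (hprovable : SCFOID.Provable (SCFOID.antecedent Γ Φ) (SCFOID.succedent Δ)) :
    SCFOID.ProvableWithElementaryCuts Γ Φ Δ := by
  choose lev hlev using hstratified
  exact SCFOID.Derives.eliminate_cuts (hcanonical.isRanked hlev) hcanonical.finite_left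
    hcanonical.finite_right hprovable
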